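/- Let $d,\mathbf d,\mathbf L,M,K,N\in\mathbb N=\{1,2,\dots\}$, $c\in[2,\infty)$, $\gamma\in\mathbb R$, and $\mathbf l=(\mathbf l_0,\dots,\mathbf l_{\mathbf L})\in\mathbb N^{\mathbf L+1}$ satisfy $\mathbf l_0=d$, $\mathbf l_{\mathbf L}=1$, and $\mathbf d\ge\sum_{i=1}^{\mathbf L}\mathbf l_i(\mathbf l_{i-1}+1)$, and write $\|\mathbf l\|_\infty=\max\{\mathbf l_0,\dots,\mathbf l_{\mathbf L}\}$. For $m,n\in\mathbb N$, $s\in\mathbb N_0$, $\theta\in\mathbb R^{\mathbf d}$ with $\mathbf d\ge s+mn+m$ let $\mathscr A^{\theta,s}_{m,n}\colon\mathbb R^n\to\mathbb R^m$ be the affine map with $$(\mathscr A^{\theta,s}_{m,n}(x))_i=\sum_{j=1}^n\theta_{s+(i-1)n+j}\,x_j+\theta_{s+mn+i},\qquad i\in\{1,\dots,m\}.$$ Let $s_k=\sum_{i=1}^{k}\mathbf l_i(\mathbf l_{i-1}+1)$, let $\mathbf a_i\colon\mathbb R^{\mathbf l_i}\to\mathbb R^{\mathbf l_i}$, $1\le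 i<\mathbf L$, be the coordinatewise rectifier $t\mapsto\max\{t,0\}$, let $\mathbf a_{\mathbf L}(t)=\max\{\min\{t,1\},0\}$ for $t\in\mathbb R$, and for every $\theta\in\mathbb R^{\mathbf d}$ let $\mathscr N_\theta\colon\mathbb R^d\to\mathbb R$ be the network $$\mathscr N_\theta=\mathbf a_{\mathbf L}\circ\mathscr A^{\theta,s_{\mathbf L-1}}_{\mathbf l_{\mathbf L},\mathbf l_{\mathbf L-1}}\circ\mathbf a_{\mathbf L-1}\circ\mathscr A^{\theta,s_{\mathbf L-2}}_{\mathbf l_{\mathbf L-1},\mathbf l_{\mathbf L-2}}\circ\dots\circ\mathbf a_1\circ\mathscr A^{\theta,0}_{\mathbf l_1,\mathbf l_0}.$$ Let $(\Omega,\mathcal F,\mathbb P)$ be a probability space, let $X_j\colon\Omega\to[0,1]^d$, $j\in\{1,\dots,M\}$, be i.i.d. random variables, and let $\mathcal E\colon[0,1]^d\to[0,1]$ satisfy $|\mathcal E(x)-\mathcal E(y)|\le c\|x-y\|_1$ for all $x,y\in[0,1]^d$. Let $\Theta_{k,n}\colon\Omega\to\mathbb R^{\mathbf d}$, $k,n\in\mathbb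 N_0$, and $\mathbf k\colon\Omega\to(\mathbb N_0)^2$ be random variables such that $\Theta_{1,0},\dots,\Theta_{K,0}$ are i.i.d. and $\Theta_{1,0}$ is uniformly distributed on $[-c,c]^{\mathbf d}$. Let $$\mathcal R(\theta,\omega)=\frac1M\sum_{j=1}^M|\mathscr N_\theta(X_j(\omega))-\mathcal E(X_j(\omega))|^2,\qquad\theta\in\mathbb R^{\mathbf d},\ \omega\in\Omega,$$ let $\mathcal G\colon\mathbb R^{\mathbf d}\times\Omega\to\mathbb R^{\mathbf d}$ satisfy $\mathcal G(\theta,\omega)=(\nabla_\theta\mathcal R)(\theta,\omega)$ for all $\omega\in\Omega$ and all $\theta$ at which $\mathcal R(\cdot,\omega)$ is differentiable, and assume for all $k,n\in\mathbb N$, $\omega\in\Omega$ that $\Theta_{k,n}(\omega)=\Theta_{k,n-1}(\omega)-\gamma\,\mathcal G(\Theta_{k,n-1}(\omega),\omega)$ and for all $\omega\in\Omega$ that $$\mathbf k(\omega)\in\arg\min\nolimits_{(k,n)\in\{1,\dots,K\}\times\{0,\dots,N\},\ \|\Theta_{k,n}(\omega)\|_\infty\le c}\mathcal R(\Theta_{k,n}(\omega),\omega).$$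 Then (with all integrals well defined and finite) $$\mathbb E\!\left[\int_{[0,1]^d}|\mathscr N_{\Theta_{\mathbf k}}(x)-\mathcal E(x)|\,\mathbb P_{X_1}(\mathrm dx)\right]\le\frac{6dc}{(\min\{2^{\mathbf L},\mathbf l_1,\dots,\mathbf l_{\mathbf L-1}\})^{1/d}}+\frac{\mathbf L(\|\mathbf l\|_\infty+1)^{\mathbf L}c^{\mathbf L+1}}{K^{(2\mathbf L)^{-1}(\|\mathbf l\|_\infty+1)^{-2}}}+\frac{4c\,\mathbf L(\|\mathbf l\|_\infty+1)\ln(eM)}{M^{1/4}}.$$ -/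

import Mathlib

open MeasureTheory ProbabilityTheory

noncomputable section

namespace ClippedDNN

/-- The unit cube `[0,1]^d`, as a subtype of `ℝ^d`. -/
abbrev Cube (d : ℕ) : Type := Set.Icc (0 : Fin d → ℝ) 1

/-- The coordinate with (zero-based) index `k` of a parameter vector. The value `0` for `k ≥ D` is
a placeholder that is never used when the vector is long enough for the network. -/
def param {D : ℕ} (θ : Fin D → ℝ) (k : ℕ) : ℝ :=
  if h : k < D then θ ⟨k, h⟩ else 0

/-- The affine map `ℝ^n → ℝ^m` whose `m × n` weight matrix is stored row by row in the coordinates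
of `θ` after the first `s` ones, followed by the `m` coordinates of the bias vector. -/
def affine {D : ℕ} (θ : Fin D → ℝ) (s m n : ℕ) (x : Fin n → ℝ) : Fin m → ℝ := fun i =>
  (∑ j : Fin n, param θ (s + (i : ℕ) * n + (j : ℕ)) * x j) + param θ (s + m * n + (i : ℕ))

/-- The number `∑_{i=1}^{k} l_i (l_{i-1} + 1)` of parameters of the first `k` layers. -/
def numParams (l : ℕ → ℕ) (k : ℕ) : ℕ :=
  ∑ i ∈ Finset.range k, l (i + 1) * (l i + 1)

/-- The multidimensional rectifier function. -/
def relu {n : ℕ} (x : Fin n → ℝ) : Fin n → ℝ := fun i => max (x i) 0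

/-- The multidimensional clipping function onto `[0,1]`. -/
def clip {n : ℕ} (x : Fin n → ℝ) : Fin n → ℝ := fun i => max (min (x i) 1) 0

/-- The output of the `k`-th hidden layer; for `k = 0` it is the input itself. -/
def hiddenLayer (l : ℕ → ℕ) {D : ℕ} (θ : Fin D → ℝ) (x : Fin (l 0) → ℝ) : (k : ℕ) → Fin (l k) → ℝ
  | 0 => x
  | k + 1 => relu (affine θ (numParams l k) (l (k + 1)) (l k) (hiddenLayer l θ x k))

/-- The network with `L` affine maps (`L ≥ 1`), rectifiers in front of the `L - 1` hidden layers
and clipping in front of the output layer. The value for `L = 0` is a placeholder. -/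
def net (l : ℕ → ℕ) {D : ℕ} (θ : Fin D → ℝ) (x : Fin (l 0) → ℝ) : (L : ℕ) → Fin (l L) → ℝ
  | 0 => x
  | L + 1 => clip (affine θ (numParams l L) (l (L + 1)) (l L) (hiddenLayer l θ x L))

/-- The network as a function `ℝ^d → ℝ`, when `l_0 = d` and `l_L = 1`. -/
def realization {d D L : ℕ} {l : ℕ → ℕ} (h0 : l 0 = d) (hL : l L = 1)
    (θ : Fin D → ℝ) (x : Fin d → ℝ) : ℝ :=
  net l θ (fun i => x (Fin.cast h0 i)) L (Fin.cast hL.symm 0)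

/-- The empirical risk of the parameter vector `θ` on the sample `(ξ_j, E(ξ_j))`, `j < M`. -/
def empiricalRisk {d D L M : ℕ} {l : ℕ → ℕ} (h0 : l 0 = d) (hL : l L = 1)
    (E : Cube d → unitInterval) (ξ : Fin M → Cube d) (θ : Fin D → ℝ) : ℝ :=
  1 / (M : ℝ) * ∑ j : Fin M, |realization h0 hL θ (ξ j : Fin d → ℝ) - (E (ξ j) : ℝ)| ^ 2

/-- The gradient (vector of partial derivatives) at `θ` of a function differentiable at `θ`. -/
def grad {D : ℕ} (f : (Fin D → ℝ) → ℝ) (θ : Fin D → ℝ) : Fin D → ℝ := fun i =>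
  fderiv ℝ f θ (Pi.single i 1)

/-- The pairs `(k, n) ∈ {1,…,K} × {0,…,N}` with `‖ϑ_{k,n}‖_∞ ≤ c`
(the norm of `Fin D → ℝ` is the maximum norm). -/
def admissible {D : ℕ} (K N : ℕ) (c : ℝ) (ϑ : ℕ → ℕ → Fin D → ℝ) : Set (ℕ × ℕ) :=
  {p | p.1 ∈ Set.Icc 1 K ∧ p.2 ∈ Set.Icc 0 N ∧ ‖ϑ p.1 p.2‖ ≤ c}

/-- The set of minimizers of `f` over `s`. -/
def argMin {α : Type*} (s : Set α) (f : α → ℝ) : Set α := {a | a ∈ s ∧ ∀ b ∈ s, f a ≤ f b}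

/-- `min {2^L, l_1, …, l_{L-1}}`. -/
def minWidth (l : ℕ → ℕ) (L : ℕ) : ℕ :=
  (insert (2 ^ L) ((Finset.Ico 1 L).image l)).min' (Finset.insert_nonempty _ _)

/-- `‖l‖_∞ = max {l_0, l_1, …, l_L}`. -/
def maxWidth (l : ℕ → ℕ) (L : ℕ) : ℕ := (Finset.range (L + 1)).sup l

end ClippedDNN

end

open ClippedDNN

/-!
The selected parameter has an empirical risk at most that of every initialization, since almost surely
all initializations are among the candidates. Hence, with `Λ` a Lipschitz constant of
`θ ↦ N_θ(x)` on parameters bounded by `c`, with any comparison parameter `ϑ` bounded by `c`, and with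
`η` a bound for the deviation of the empirical risk from the true risk over all parameters bounded by
`c`, the `L²`-error of the selected network is at most
`sup |N_ϑ - E| + Λ min_k ‖Θ_{k,0} - ϑ‖ + √(2η)`. The three summands are estimated separately.

* Approximation (`exists_abs_realization_sub_le`): `E` is close to its `c`-Lipschitz minorant
  `max_p (E (t_p) - c ‖x - t_p‖₁)` over grid points `t_p`. The first hidden layer computes the
  distances, and each further layer halves the number of functions of which the maximum is to be
  taken. A depth logarithmic in the number of grid points suffices, hence the `2 ^ L` in `minWidth`.
* Optimization (`integral_inf_headDist_le`): an initialization is within `2 c u` of `ϑ`, in the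
  `p = numParams l L` coordinates that the network uses, with probability at least `u ^ p`. By
  independence and the layer-cake formula, the `p`-th moment of the smallest distance, divided by
  `2 c`, is at most `1 / (K + 1)`, and Jensen's inequality bounds its mean.
* Generalization (`exists_measurableSet_abs_risk_sub_le`): Hoeffding's inequality on a grid of
  parameters and Lipschitz continuity between the grid points bound the deviation outside a small
  event. On that event the error is at most `1`, so no measurability of the supremum over all
  parameters is needed.
-/

namespace ClippedDNN

/-! ### Lipschitz dependence of the network on its parameters -/

theorem numParams_succ (l : ℕ → ℕ) (k : ℕ) :
    numParams l (k + 1) = numParams l k + l (k + 1) * (l k + 1) :=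
  Finset.sum_range_succ _ _

theorem numParams_mono (l : ℕ → ℕ) : Monotone (numParams l) :=
  monotone_nat_of_le_succ fun k => by rw [numParams_succ]; omega

theorem numParams_le {l : ℕ → ℕ} {L m : ℕ} (hm : ∀ i ≤ L, l i ≤ m) :
    numParams l L ≤ L * (m * (m + 1)) := by
  have := Finset.sum_le_card_nsmul (Finset.range L) (fun i => l (i + 1) * (l i + 1))
    (m * (m + 1)) fun i hi => by
      have hi := Finset.mem_range.1 hi
      have h1 := hm (i + 1) hi
      have h2 := hm i hi.le
      gcongr
  simpa [numParams] using this

theorem le_maxWidth (l : ℕ → ℕ) (L : ℕ) : ∀ i ≤ L, l i ≤ maxWidth l L := fun i hi =>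
  Finset.le_sup (f := l) (Finset.mem_range.2 (by omega))

theorem weight_index_lt {s m n i j : ℕ} (hi : i < m) (hj : j < n) :
    s + i * n + j < s + m * n := by
  have : (i + 1) * n ≤ m * n := Nat.mul_le_mul_right _ hi
  linarith [add_mul i 1 n]

theorem abs_param_le {D : ℕ} {θ : Fin D → ℝ} {c : ℝ} (hθ : ‖θ‖ ≤ c) (k : ℕ) :
    |param θ k| ≤ c := by
  unfold param
  split_ifs with h
  · exact (norm_le_pi_norm θ ⟨k, h⟩).trans hθ
  · simpa using (norm_nonneg θ).trans hθ

section Affine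

variable {D s m n : ℕ} {θ ϑ : Fin D → ℝ} {c δ H Δ : ℝ}

theorem affine_congr (h : ∀ k < s + m * (n + 1), param θ k = param ϑ k) (x : Fin n → ℝ) :
    affine θ s m n x = affine ϑ s m n x := by
  rw [mul_add, mul_one] at h
  funext i
  unfold affine
  congr 1
  · refine Finset.sum_congr rfl fun j _ => ?_
    rw [h _ (by have := weight_index_lt (s := s) i.2 j.2; omega)]
  · exact h _ (by omega)

theorem abs_affine_le (hθ : ‖θ‖ ≤ c) {x : Fin n → ℝ} (hx : ∀ j, |x j| ≤ H) (i : Fin m) :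
    |affine θ s m n x i| ≤ c * (n * H + 1) := by
  have hc : 0 ≤ c := (norm_nonneg _).trans hθ
  have hsum : |∑ j : Fin n, param θ (s + (i : ℕ) * n + (j : ℕ)) * x j| ≤ n * (c * H) := by
    refine (Finset.abs_sum_le_sum_abs _ _).trans ?_
    refine (Finset.sum_le_card_nsmul _ _ (c * H) fun j _ => ?_).trans (by simp)
    rw [abs_mul]
    exact mul_le_mul (abs_param_le hθ _) (hx j) (abs_nonneg _) hc
  have hb := abs_param_le hθ (s + m * n + (i : ℕ))
  calc _ ≤ _ := abs_add_le _ _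
    _ ≤ n * (c * H) + c := add_le_add hsum hb
    _ = _ := by ring

theorem abs_affine_sub_le (hθ : ‖θ‖ ≤ c)
    (h : ∀ k < s + m * (n + 1), |param θ k - param ϑ k| ≤ δ) {x y : Fin n → ℝ}
    (hy : ∀ j, |y j| ≤ H) (hxy : ∀ j, |x j - y j| ≤ Δ) (i : Fin m) :
    |affine θ s m n x i - affine ϑ s m n y i| ≤ n * (c * Δ) + δ * (n * H + 1) := by
  rw [mul_add, mul_one] at h
  have hc : 0 ≤ c := (norm_nonneg _).trans hθ
  have hδ : 0 ≤ δ := (abs_nonneg _).trans (h (s + m * n + i) (by omega))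
  have hsum : |∑ j : Fin n, (param θ (s + (i : ℕ) * n + (j : ℕ)) * (x j - y j) +
      (param θ (s + (i : ℕ) * n + (j : ℕ)) - param ϑ (s + (i : ℕ) * n + (j : ℕ))) * y j)|
      ≤ n * (c * Δ + δ * H) := by
    refine (Finset.abs_sum_le_sum_abs _ _).trans ?_
    refine (Finset.sum_le_card_nsmul _ _ (c * Δ + δ * H) fun j _ => ?_).trans
      (by simp [mul_add])
    refine (abs_add_le _ _).trans ?_
    rw [abs_mul, abs_mul]
    exact add_le_add (mul_le_mul (abs_param_le hθ _) (hxy j) (abs_nonneg _) hc)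
      (mul_le_mul (h _ (by have := weight_index_lt (s := s) i.2 j.2; omega)) (hy j)
        (abs_nonneg _) hδ)
  have hb := h (s + m * n + (i : ℕ)) (by omega)
  have key : affine θ s m n x i - affine ϑ s m n y i =
      (∑ j : Fin n, (param θ (s + (i : ℕ) * n + (j : ℕ)) * (x j - y j) +
      (param θ (s + (i : ℕ) * n + (j : ℕ)) - param ϑ (s + (i : ℕ) * n + (j : ℕ))) * y j)) +
      (param θ (s + m * n + (i : ℕ)) - param ϑ (s + m * n + (i : ℕ))) := by
    unfold affine
    rw [add_sub_add_comm, ← Finset.sum_sub_distrib]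
    congr 1
    exact Finset.sum_congr rfl fun j _ => by ring
  rw [key]
  calc _ ≤ _ := abs_add_le _ _
    _ ≤ n * (c * Δ + δ * H) + δ := add_le_add hsum hb
    _ = _ := by ring

end Affine

theorem hiddenLayer_congr {l : ℕ → ℕ} {D : ℕ} {θ ϑ : Fin D → ℝ} (x : Fin (l 0) → ℝ) {k : ℕ}
    (h : ∀ i < numParams l k, param θ i = param ϑ i) :
    hiddenLayer l θ x k = hiddenLayer l ϑ x k := by
  induction k with
  | zero => rfl
  | succ k ih =>
    have hk := numParams_succ l k
    simp only [hiddenLayer]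
    rw [ih fun i hi => h i (by omega), affine_congr fun i hi => h i (by omega)]

theorem abs_relu_le {n : ℕ} {x : Fin n → ℝ} {H : ℝ} {i : Fin n} (h : |x i| ≤ H) :
    |relu x i| ≤ H := by
  have := abs_max_sub_max_le_abs (x i) 0 0
  simp only [max_self, sub_zero] at this
  exact this.trans h

theorem abs_relu_sub_le {n : ℕ} (x y : Fin n → ℝ) (i : Fin n) :
    |relu x i - relu y i| ≤ |x i - y i| := abs_max_sub_max_le_abs _ _ _

theorem abs_clip_sub_le {n : ℕ} (x y : Fin n → ℝ) (i : Fin n) :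
    |clip x i - clip y i| ≤ |x i - y i| :=
  (abs_max_sub_max_le_abs _ _ _).trans (abs_inf_sub_inf_le_abs _ _ _)

section Lipschitz

variable {l : ℕ → ℕ} {D m : ℕ} {θ ϑ : Fin D → ℝ} {c δ : ℝ} {x : Fin (l 0) → ℝ}

theorem abs_hiddenLayer_le (hc : 1 ≤ c) (hθ : ‖θ‖ ≤ c) (hx : ∀ i, |x i| ≤ 1) {k : ℕ}
    (hm : ∀ i ≤ k, l i ≤ m) (i : Fin (l k)) :
    |hiddenLayer l θ x k i| ≤ ((m + 1) * c) ^ k := by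
  induction k with
  | zero => simpa [hiddenLayer] using hx i
  | succ k ih =>
    have h1 : (1 : ℝ) ≤ ((m + 1) * c) ^ k :=
      one_le_pow₀ (by nlinarith [(Nat.cast_nonneg m : (0 : ℝ) ≤ m)])
    have h2 : (l k : ℝ) ≤ m := by exact_mod_cast hm k (by omega)
    refine (abs_relu_le (abs_affine_le hθ (fun j => ih (fun i hi => hm i (by omega)) j) i)).trans ?_
    calc c * (l k * ((m + 1) * c) ^ k + 1) ≤ c * (m * ((m + 1) * c) ^ k + ((m + 1) * c) ^ k) := by
          gcongr
      _ = _ := by ring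

/-- The bound is multiplied by `c`, which avoids the exponent `k - 1`. -/
theorem mul_abs_hiddenLayer_sub_le (hc : 1 ≤ c) (hθ : ‖θ‖ ≤ c) (hϑ : ‖ϑ‖ ≤ c)
    (hx : ∀ i, |x i| ≤ 1) {k : ℕ} (hm : ∀ i ≤ k, l i ≤ m) (hδ : 0 ≤ δ)
    (h : ∀ i < numParams l k, |param θ i - param ϑ i| ≤ δ) (i : Fin (l k)) :
    c * |hiddenLayer l θ x k i - hiddenLayer l ϑ x k i| ≤ k * ((m + 1) * c) ^ k * δ := by
  induction k with
  | zero => simp [hiddenLayer]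
  | succ k ih =>
    have hk := numParams_succ l k
    have h' := hk ▸ h
    have hc0 : 0 < c := by linarith
    have h1 : (1 : ℝ) ≤ ((m + 1) * c) ^ k :=
      one_le_pow₀ (by nlinarith [(Nat.cast_nonneg m : (0 : ℝ) ≤ m)])
    have h2 : (l k : ℝ) ≤ m := by exact_mod_cast hm k (by omega)
    have ih' : ∀ j, |hiddenLayer l θ x k j - hiddenLayer l ϑ x k j| ≤
        k * ((m + 1) * c) ^ k * δ / c := fun j => by
      rw [le_div_iff₀' hc0]
      exact ih (fun i hi => hm i (by omega)) (fun i hi => h i (by omega)) j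
    have h3 := (abs_relu_sub_le _ _ i).trans
      (abs_affine_sub_le (m := l (k + 1)) hθ h'
        (abs_hiddenLayer_le hc hϑ hx fun i hi => hm i (by omega)) ih' i)
    rw [mul_div_cancel₀ _ hc0.ne'] at h3
    calc _ ≤ c * (l k * (k * ((m + 1) * c) ^ k * δ) + δ * (l k * ((m + 1) * c) ^ k + 1)) := by
          gcongr; exact h3
      _ ≤ c * ((m + 1) * (k * ((m + 1) * c) ^ k * δ) +
          δ * (m * ((m + 1) * c) ^ k + ((m + 1) * c) ^ k)) := by
          gcongr; linarith
      _ = _ := by push_cast; ring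

/-- On the unit cube, and for parameters bounded by `c`, the network is Lipschitz continuous in
those parameters which it uses. -/
theorem abs_realization_sub_le {d L : ℕ} (h0 : l 0 = d) (hL : l L = 1) (hLpos : 0 < L)
    (hc : 1 ≤ c) (hθ : ‖θ‖ ≤ c) (hϑ : ‖ϑ‖ ≤ c) (hm : ∀ i ≤ L, l i ≤ m) (hδ : 0 ≤ δ)
    (h : ∀ i < numParams l L, |param θ i - param ϑ i| ≤ δ) (y : Cube d) :
    |realization h0 hL θ y - realization h0 hL ϑ y| ≤ L * (m + 1) ^ L * c ^ (L - 1) * δ := by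
  obtain ⟨k, rfl⟩ : ∃ k, L = k + 1 := ⟨L - 1, by omega⟩
  have hk := numParams_succ l k
  have h' := hk ▸ h
  have hc0 : 0 < c := by linarith
  have hx : ∀ i : Fin (l 0), |(fun i => (y : Fin d → ℝ) (Fin.cast h0 i)) i| ≤ 1 := fun i =>
    abs_le.2 ⟨by linarith [show (0 : ℝ) ≤ _ from y.2.1 (Fin.cast h0 i)], y.2.2 _⟩
  have h1 : (1 : ℝ) ≤ ((m + 1) * c) ^ k :=
    one_le_pow₀ (by nlinarith [(Nat.cast_nonneg m : (0 : ℝ) ≤ m)])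
  have h2 : (l k : ℝ) ≤ m := by exact_mod_cast hm k (by omega)
  have ih' : ∀ j, |hiddenLayer l θ _ k j - hiddenLayer l ϑ _ k j| ≤
      k * ((m + 1) * c) ^ k * δ / c := fun j => by
    rw [le_div_iff₀' hc0]
    exact mul_abs_hiddenLayer_sub_le hc hθ hϑ hx (fun i hi => hm i (by omega)) hδ
      (fun i hi => h i (by omega)) j
  have h3 := (abs_clip_sub_le _ _ (Fin.cast hL.symm 0)).trans
      (abs_affine_sub_le (m := l (k + 1)) hθ h'
        (abs_hiddenLayer_le hc hϑ hx fun i hi => hm i (by omega)) ih' (Fin.cast hL.symm 0))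
  rw [mul_div_cancel₀ _ hc0.ne'] at h3
  calc _ ≤ l k * (k * ((m + 1) * c) ^ k * δ) + δ * (l k * ((m + 1) * c) ^ k + 1) := h3
    _ ≤ (m + 1) * (k * ((m + 1) * c) ^ k * δ) +
          δ * (m * ((m + 1) * c) ^ k + ((m + 1) * c) ^ k) := by
        gcongr; linarith
    _ = _ := by rw [Nat.add_sub_cancel, mul_pow]; push_cast; ring

end Lipschitz

theorem realization_mem_Icc {d D L : ℕ} {l : ℕ → ℕ} (h0 : l 0 = d) (hL : l L = 1)
    (hLpos : 0 < L) (θ : Fin D → ℝ) (x : Fin d → ℝ) :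
    realization h0 hL θ x ∈ Set.Icc (0 : ℝ) 1 := by
  obtain ⟨k, rfl⟩ : ∃ k, L = k + 1 := ⟨L - 1, by omega⟩
  exact ⟨le_max_right _ _, max_le (min_le_right _ _) zero_le_one⟩

theorem abs_sub_le_one {a b : ℝ} (ha : a ∈ Set.Icc (0 : ℝ) 1) (hb : b ∈ Set.Icc (0 : ℝ) 1) :
    |a - b| ≤ 1 := abs_le.2 ⟨by linarith [ha.1, hb.2], by linarith [ha.2, hb.1]⟩

/-! ### Approximation of Lipschitz functions by networks with bounded parameters -/

/-- The parameters after the first `s` ones can be chosen so that they encode a given affine map. -/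
theorem exists_affine_eq {D s m n : ℕ} (hs : s + m * (n + 1) ≤ D) {θ : Fin D → ℝ} {c : ℝ}
    (hθ : ‖θ‖ ≤ c) (A : Fin m → Fin n → ℝ) (B : Fin m → ℝ) (hA : ∀ i j, |A i j| ≤ c)
    (hB : ∀ i, |B i| ≤ c) :
    ∃ θ' : Fin D → ℝ, ‖θ'‖ ≤ c ∧ (∀ k < s, param θ' k = param θ k) ∧
      ∀ x i, affine θ' s m n x i = ∑ j, A i j * x j + B i := by
  have hc : 0 ≤ c := (norm_nonneg _).trans hθ
  rw [mul_add, mul_one] at hs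
  refine ⟨fun k => if (k : ℕ) < s then θ k else
      if h : (k : ℕ) - s < m * n then
        A ⟨(k - s) / n, Nat.div_lt_of_lt_mul (by rwa [mul_comm])⟩
          ⟨(k - s) % n, Nat.mod_lt _ (Nat.pos_of_ne_zero (by rintro rfl; simp at h))⟩
      else if h : (k : ℕ) - s - m * n < m then B ⟨k - s - m * n, h⟩ else 0, ?_, ?_, ?_⟩
  · refine (pi_norm_le_iff_of_nonneg hc).2 fun k => ?_
    split_ifs
    · exact (norm_le_pi_norm θ k).trans hθ
    · exact hA _ _
    · exact hB _
    · simpa using hc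
  · intro k hk
    have hkD : k < D := by omega
    simp [param, hk, hkD]
  · intro x i
    unfold affine
    congr 1
    · refine Finset.sum_congr rfl fun j _ => ?_
      have hlt := weight_index_lt (s := s) i.2 j.2
      have e1 : s + (i : ℕ) * n + j - s = j + n * i := by rw [mul_comm n]; omega
      have e2 : (j + n * i : ℕ) / n = i := by
        rw [Nat.add_mul_div_left _ _ (by have := j.2; omega), Nat.div_eq_of_lt j.2, zero_add]
      have e3 : (j + n * i : ℕ) % n = j := by
        rw [Nat.add_mul_mod_self_left, Nat.mod_eq_of_lt j.2]
      have h3 : ↑j + n * ↑i < m * n := by omega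
      rw [param, dif_pos (by omega)]
      dsimp only
      rw [if_neg (by omega)]
      simp only [e1, e2, e3, h3, dif_pos]
    · have e1 : s + m * n + (i : ℕ) - s = m * n + i := by omega
      have e2 : ¬ (m * n + (i : ℕ) < m * n) := by omega
      have e3 : m * n + (i : ℕ) - m * n = i := by omega
      rw [param, dif_pos (by omega)]
      dsimp only
      rw [if_neg (by omega)]
      simp [e1, e2, e3]

theorem sum_extend_mul {ι κ : Type*} [Fintype ι] [Fintype κ] (e : ι ↪ κ) (f : ι → ℝ) (h : κ → ℝ) :
    ∑ i, Function.extend e f 0 i * h i = ∑ p, f p * h (e p) := by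
  symm
  refine Fintype.sum_of_injective e e.injective _ _ (fun i hi => ?_) fun p => ?_
  · rw [Function.extend_apply' _ _ _ (by simpa using hi)]; simp
  · rw [e.injective.extend_apply]

theorem abs_extend_le {ι κ : Type*} (e : ι ↪ κ) {f : ι → ℝ} {c : ℝ} (hc : 0 ≤ c)
    (hf : ∀ p, |f p| ≤ c) (i : κ) : |Function.extend e f 0 i| ≤ c := by
  by_cases h : ∃ p, e p = i
  · obtain ⟨p, rfl⟩ := h
    rw [e.injective.extend_apply]; exact hf p
  · rw [Function.extend_apply' _ _ _ h]; simpa using hc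

theorem abs_extend_sub_le {ι κ : Type*} (e : ι ↪ κ) {f g : ι → ℝ} {c : ℝ} (hc : 0 ≤ c)
    (hf : ∀ p, |f p - g p| ≤ c) (i : κ) :
    |Function.extend e f 0 i - Function.extend e g 0 i| ≤ c := by
  by_cases h : ∃ p, e p = i
  · obtain ⟨p, rfl⟩ := h
    rw [e.injective.extend_apply, e.injective.extend_apply]; exact hf p
  · rw [Function.extend_apply' _ _ _ h, Function.extend_apply' _ _ _ h]; simpa using hc

/-- For a suitable parameter vector bounded by `c`, the function `F` is the pointwise maximum of `n`
affine functions of the `k`-th hidden layer. The coefficients of these functions, and the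
differences of the coefficients of any two of them, are bounded by `c`: the next layer can then
compute pairwise maxima with weights bounded by `c`. -/
def IsMaxOfHiddenLayer (l : ℕ → ℕ) (D : ℕ) (c : ℝ) (k n : ℕ) (F : (Fin (l 0) → ℝ) → ℝ) : Prop :=
  ∃ θ : Fin D → ℝ, ‖θ‖ ≤ c ∧ ∃ (w : Fin n → Fin (l k) → ℝ) (b : Fin n → ℝ),
    (∀ p i, |w p i| ≤ c) ∧ (∀ p q i, |w p i - w q i| ≤ c) ∧
    (∀ p, |b p| ≤ c) ∧ (∀ p q, |b p - b q| ≤ c) ∧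
    ∀ x, IsGreatest (Set.range fun p => ∑ i, w p i * hiddenLayer l θ x k i + b p) (F x)

theorem max_eq_relu (a b : ℝ) : max (a - b) 0 + max b 0 - max (-b) 0 = max a b := by
  rcases le_total a b with h | h <;> rcases le_total 0 b with h' | h' <;>
    simp [h, h']

section MaxOfHiddenLayer

variable {l : ℕ → ℕ} {D : ℕ} {c : ℝ} {F : (Fin (l 0) → ℝ) → ℝ}

/-- One more layer halves the number of functions, by `max a b = (a - b)⁺ + b⁺ - (-b)⁺`. If the
number is odd, the last function is paired with itself. -/
theorem IsMaxOfHiddenLayer.succ {k n : ℕ} (hc : 1 ≤ c) (hD : numParams l (k + 1) ≤ D)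
    (hn : 3 * ((n + 1) / 2) ≤ l (k + 1)) (h : IsMaxOfHiddenLayer l D c k n F) :
    IsMaxOfHiddenLayer l D c (k + 1) ((n + 1) / 2) F := by
  obtain ⟨θ, hθ, w, b, hw, hww, hb, hbb, hF⟩ := h
  have hc0 : 0 ≤ c := by linarith
  let fst : Fin ((n + 1) / 2) → Fin n := fun q => ⟨2 * q, by have := q.2; omega⟩
  let snd : Fin ((n + 1) / 2) → Fin n := fun q =>
    ⟨min (2 * q + 1) (n - 1), by have := q.2; omega⟩
  obtain ⟨e⟩ : Nonempty (Fin ((n + 1) / 2) × Fin 3 ↪ Fin (l (k + 1))) :=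
    Function.Embedding.nonempty_of_card_le (by simpa [mul_comm] using hn)
  let f : Fin (l k) → Fin ((n + 1) / 2) × Fin 3 → ℝ := fun j p =>
    ![w (fst p.1) j - w (snd p.1) j, w (snd p.1) j, -w (snd p.1) j] p.2
  let g : Fin ((n + 1) / 2) × Fin 3 → ℝ := fun p =>
    ![b (fst p.1) - b (snd p.1), b (snd p.1), -b (snd p.1)] p.2
  have hf : ∀ j p, |f j p| ≤ c := by
    rintro j ⟨q, t⟩
    fin_cases t
    · exact hww _ _ _
    · exact hw _ _
    · simpa [f] using hw (snd q) j
  have hg : ∀ p, |g p| ≤ c := by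
    rintro ⟨q, t⟩
    fin_cases t
    · exact hbb _ _
    · exact hb _
    · simpa [g] using hb (snd q)
  obtain ⟨θ', hθ', hlow, haff⟩ := exists_affine_eq (by rwa [numParams_succ] at hD) hθ
    (fun i j => Function.extend e (f j) 0 i) (Function.extend e g 0)
    (fun i j => abs_extend_le e hc0 (hf j) i) (abs_extend_le e hc0 hg)
  let v : Fin ((n + 1) / 2) → Fin ((n + 1) / 2) × Fin 3 → ℝ := fun q p =>
    if p.1 = q then ![1, 1, -1] p.2 else 0
  have hv : ∀ q p, v q p ∈ Set.Icc (-1 : ℝ) 1 ∧ ∀ q', |v q p - v q' p| ≤ 1 := by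
    rintro q ⟨q', t⟩
    refine ⟨?_, fun q'' => ?_⟩ <;>
    · fin_cases t <;> simp only [v] <;> split_ifs <;> norm_num
  refine ⟨θ', hθ', fun q => Function.extend e (v q) 0, 0,
    fun q => abs_extend_le e hc0 fun p => (abs_le.2 (hv q p).1).trans hc,
    fun q q' => abs_extend_sub_le e hc0 fun p => ((hv q p).2 q').trans hc,
    by simpa using fun _ => hc0, by simpa using fun _ _ => hc0, fun x => ?_⟩
  set z : Fin n → ℝ := fun p => ∑ i, w p i * hiddenLayer l θ x k i + b p with hz
  have hlayer : ∀ p, hiddenLayer l θ' x (k + 1) (e p) =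
      max (∑ j, f j p * hiddenLayer l θ x k j + g p) 0 := fun p => by
    simp only [hiddenLayer, relu, hiddenLayer_congr x hlow, haff, e.injective.extend_apply]
  have hmax : ∀ q, ∑ i, Function.extend e (v q) 0 i * hiddenLayer l θ' x (k + 1) i
      + (0 : Fin ((n + 1) / 2) → ℝ) q = max (z (fst q)) (z (snd q)) := fun q => by
    rw [sum_extend_mul, Fintype.sum_prod_type, Finset.sum_eq_single q]
    · rw [← max_eq_relu, Fin.sum_univ_three, hlayer, hlayer, hlayer]
      simp only [v, f, g, if_true, Matrix.cons_val_zero, Matrix.cons_val_one, Matrix.cons_val,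
        Pi.zero_apply, add_zero, one_mul, neg_mul, sub_mul, Finset.sum_sub_distrib,
        Finset.sum_neg_distrib, hz]
      ring_nf
    · intro q' _ hq'
      simp [v, hq']
    · simp
  simp only [hmax]
  obtain ⟨⟨p, hp⟩, hub⟩ := hF x
  have hle : ∀ q, z q ≤ F x := fun q => hub ⟨q, rfl⟩
  refine ⟨⟨⟨p / 2, by have := p.2; omega⟩, ?_⟩, ?_⟩
  · refine le_antisymm (max_le (hle _) (hle _)) ?_
    rcases Nat.even_or_odd' p with ⟨r, hr | hr⟩
    · refine le_max_of_le_left (ge_of_eq ?_)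
      have : fst ⟨p / 2, by have := p.2; omega⟩ = p := Fin.ext (by simp only [fst]; omega)
      rw [this]; exact hp
    · refine le_max_of_le_right (ge_of_eq ?_)
      have : snd ⟨p / 2, by have := p.2; omega⟩ = p :=
        Fin.ext (by have := p.2; simp only [snd]; omega)
      rw [this]; exact hp
  · rintro _ ⟨q, rfl⟩
    exact max_le (hle _) (hle _)

theorem IsMaxOfHiddenLayer.add (hc : 1 ≤ c) {s k n : ℕ} (hn0 : 0 < n) (hn : n ≤ 2 ^ s)
    (hD : numParams l (k + s) ≤ D) (hl : ∀ i, k < i → i ≤ k + s → 3 * n ≤ l i)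
    (h : IsMaxOfHiddenLayer l D c k n F) : IsMaxOfHiddenLayer l D c (k + s) 1 F := by
  induction s generalizing k n with
  | zero =>
    obtain rfl : n = 1 := by simp at hn; omega
    exact h
  | succ s ih =>
    rw [pow_succ] at hn
    have h1 : numParams l (k + 1) ≤ numParams l (k + (s + 1)) := numParams_mono l (by omega)
    have h2 := hl (k + 1) (by omega) (by omega)
    have e : k + (s + 1) = k + 1 + s := by omega
    rw [e] at hD hl h1 ⊢
    exact ih (by omega) (by omega) hD (fun i hi hi' => by have := hl i (by omega) hi'; omega)
      (h.succ hc (by omega) (by omega))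

/-- Two neurons `(xᵢ - tᵢ)⁺` and `(tᵢ - xᵢ)⁺` for each coordinate of each of the points `t` make up
the distances `‖x - t‖₁`. -/
theorem isMaxOfHiddenLayer_one {n : ℕ} (hc : 1 ≤ c) (hD : numParams l 1 ≤ D)
    (hn : n * (l 0 * 2) ≤ l 1) (t : Fin n → Fin (l 0) → ℝ) (ht : ∀ p i, t p i ∈ Set.Icc (0 : ℝ) 1)
    (y : Fin n → ℝ) (hy : ∀ p, y p ∈ Set.Icc (0 : ℝ) 1)
    (hF : ∀ x, IsGreatest (Set.range fun p => y p - c * ∑ i, |x i - t p i|) (F x)) :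
    IsMaxOfHiddenLayer l D c 1 n F := by
  have hc0 : 0 ≤ c := by linarith
  obtain ⟨e⟩ : Nonempty (Fin n × Fin (l 0) × Fin 2 ↪ Fin (l 1)) :=
    Function.Embedding.nonempty_of_card_le (by simpa using hn)
  let f : Fin (l 0) → Fin n × Fin (l 0) × Fin 2 → ℝ := fun j p =>
    if j = p.2.1 then ![1, -1] p.2.2 else 0
  let g : Fin n × Fin (l 0) × Fin 2 → ℝ := fun p => ![-t p.1 p.2.1, t p.1 p.2.1] p.2.2
  have hf : ∀ j p, |f j p| ≤ c := by
    rintro j ⟨q, i, r⟩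
    fin_cases r <;> simp only [f] <;> split_ifs <;> simp [hc, hc0]
  have hg : ∀ p, |g p| ≤ c := by
    rintro ⟨q, i, r⟩
    have := ht q i
    have : |t q i| ≤ c := abs_le.2 ⟨by linarith [this.1], by linarith [this.2]⟩
    fin_cases r <;> simpa [g] using this
  obtain ⟨θ, hθ, -, haff⟩ := exists_affine_eq (D := D) (θ := 0) (s := numParams l 0)
    (by rwa [numParams_succ] at hD) (by simpa using hc0)
    (fun i j => Function.extend e (f j) 0 i) (Function.extend e g 0)
    (fun i j => abs_extend_le e hc0 (hf j) i) (abs_extend_le e hc0 hg)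
  let v : Fin n → Fin n × Fin (l 0) × Fin 2 → ℝ := fun q p => if p.1 = q then -c else 0
  refine ⟨θ, hθ, fun q => Function.extend e (v q) 0, y,
    fun q => abs_extend_le e hc0 fun p => ?_,
    fun q q' => abs_extend_sub_le e hc0 fun p => ?_,
    fun p => ?_, fun p q => (abs_sub_le_one (hy p) (hy q)).trans hc, fun x => ?_⟩
  · simp only [v]; split_ifs <;> simp [abs_of_nonneg hc0, hc0]
  · simp only [v]; split_ifs <;> simp [abs_of_nonneg hc0, hc0]
  · rw [abs_of_nonneg (hy p).1]; exact (hy p).2.trans hc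
  · have hlayer : ∀ p, hiddenLayer l θ x 1 (e p) = max (∑ j, f j p * x j + g p) 0 := fun p => by
      simp only [hiddenLayer, relu, haff, e.injective.extend_apply]
    convert! hF x using 3 with q
    rw [sum_extend_mul, Fintype.sum_prod_type, Finset.sum_eq_single q, add_comm, sub_eq_add_neg,
      ← neg_mul, Finset.mul_sum, Fintype.sum_prod_type]
    · congr 1
      refine Finset.sum_congr rfl fun i _ => ?_
      rw [Fin.sum_univ_two, hlayer, hlayer]
      simp only [v, f, g, if_true, Matrix.cons_val_zero, Matrix.cons_val_one, ite_mul, zero_mul,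
        Finset.sum_ite_eq', Finset.mem_univ, one_mul, neg_mul]
      rw [← neg_add, ← mul_add]
      congr 2
      rw [← sub_eq_add_neg, neg_add_eq_sub, ← neg_sub (x i) (t q i),
        max_zero_add_max_neg_zero_eq_abs_self]
    · intro q' _ hq'
      simp [v, hq']
    · simp

theorem IsMaxOfHiddenLayer.exists_net_eq {k : ℕ} (hD : numParams l (k + 1) ≤ D)
    (h : IsMaxOfHiddenLayer l D c k 1 F) :
    ∃ θ : Fin D → ℝ, ‖θ‖ ≤ c ∧ ∀ x i, net l θ x (k + 1) i = max (min (F x) 1) 0 := by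
  obtain ⟨θ, hθ, w, b, hw, -, hb, -, hF⟩ := h
  obtain ⟨θ', hθ', hlow, haff⟩ := exists_affine_eq (by rwa [numParams_succ] at hD) hθ
    (fun _ => w 0) (fun _ => b 0) (fun _ => hw 0) (fun _ => hb 0)
  refine ⟨θ', hθ', fun x i => ?_⟩
  obtain ⟨⟨p, hp⟩, -⟩ := hF x
  rw [Subsingleton.elim p 0] at hp
  simp only [net, clip, hiddenLayer_congr x hlow, haff]
  rw [← hp]

end MaxOfHiddenLayer

/-- The midpoints of `n` equal subintervals of `[0,1]`. -/
noncomputable def midpoint01 (n : ℕ) (p : Fin n) : ℝ := (2 * (p : ℕ) + 1) / (2 * n)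

theorem midpoint01_mem {n : ℕ} (p : Fin n) : midpoint01 n p ∈ Set.Icc (0 : ℝ) 1 := by
  have hp : ((p : ℕ) : ℝ) + 1 ≤ n := by exact_mod_cast p.2
  have hp0 : (0 : ℝ) ≤ (p : ℕ) := Nat.cast_nonneg _
  exact ⟨by unfold midpoint01; positivity,
    by unfold midpoint01; exact div_le_one_of_le₀ (by linarith) (by linarith)⟩

theorem exists_abs_sub_midpoint01_le {n : ℕ} (hn : 0 < n) {y : ℝ} (hy : y ∈ Set.Icc (0 : ℝ) 1) :
    ∃ p, |y - midpoint01 n p| ≤ 1 / (2 * n) := by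
  have hn' : (0 : ℝ) < n := by exact_mod_cast hn
  have key : ∀ p : Fin n, ((p : ℕ) : ℝ) ≤ y * n → y * n ≤ (p : ℕ) + 1 →
      |y - midpoint01 n p| ≤ 1 / (2 * n) := fun p h1 h2 => by
    have : y - midpoint01 n p = (2 * (y * n) - (2 * (p : ℕ) + 1)) / (2 * n) := by
      unfold midpoint01; field_simp
    rw [this, abs_div, abs_of_pos (by positivity : (0 : ℝ) < 2 * n)]
    gcongr
    exact abs_le.2 ⟨by linarith, by linarith⟩
  rcases lt_or_ge ⌊y * n⌋₊ n with h | h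
  · exact ⟨⟨_, h⟩, key _ (Nat.floor_le (mul_nonneg hy.1 hn'.le)) (Nat.lt_floor_add_one _).le⟩
  · -- only the right endpoint `y = 1` is rounded down to the index `n`
    have h' : (n : ℝ) ≤ y * n := (Nat.le_floor_iff (mul_nonneg hy.1 hn'.le)).1 h
    have h1 : y * n ≤ n := by nlinarith [hy.2]
    refine ⟨⟨n - 1, by omega⟩, key _ ?_ ?_⟩ <;> push_cast [Nat.cast_sub hn] <;> linarith

theorem minWidth_le_two_pow (l : ℕ → ℕ) (L : ℕ) : minWidth l L ≤ 2 ^ L :=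
  Finset.min'_le _ _ (Finset.mem_insert_self _ _)

theorem minWidth_le {l : ℕ → ℕ} {L i : ℕ} (h1 : 1 ≤ i) (hL : i < L) : minWidth l L ≤ l i :=
  Finset.min'_le _ _ (Finset.mem_insert_of_mem
    (Finset.mem_image_of_mem l (Finset.mem_Ico.2 ⟨h1, hL⟩)))

theorem minWidth_pos {l : ℕ → ℕ} {L : ℕ} (hl : ∀ i ≤ L, 0 < l i) : 0 < minWidth l L := by
  have := Finset.min'_mem (insert (2 ^ L) ((Finset.Ico 1 L).image l)) (Finset.insert_nonempty _ _)
  change minWidth l L ∈ _ at this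
  rcases Finset.mem_insert.1 this with h | h
  · rw [h]; positivity
  · obtain ⟨i, hi, h⟩ := Finset.mem_image.1 h
    rw [← h]; exact hl i (Finset.mem_Ico.1 hi).2.le

/-- A number `n` of grid points per coordinate which is small enough for the construction to fit into
the architecture, and large enough for the accuracy `d c / n` to be at most `6 d c / W ^ (1 / d)`. -/
theorem exists_grid_size {d W : ℕ} (hd : 0 < d) {c : ℝ} (hc : 2 ≤ c)
    (hW : 6 * d * c < (W : ℝ) ^ (1 / (d : ℝ))) :
    ∃ n : ℕ, 0 < n ∧ n ^ d * 4 ^ d ≤ W ∧ (W : ℝ) ^ (1 / (d : ℝ)) ≤ 6 * n := by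
  set r := (W : ℝ) ^ (1 / (d : ℝ)) with hr
  have hd' : (1 : ℝ) ≤ d := by exact_mod_cast hd
  have h12 : 12 < r := by nlinarith
  have hrd : r ^ d = W := by
    rw [hr, one_div, Real.rpow_inv_natCast_pow (Nat.cast_nonneg _) hd.ne']
  refine ⟨⌈r / 6⌉₊, Nat.ceil_pos.2 (by linarith), ?_, ?_⟩
  · have h1 : (⌈r / 6⌉₊ : ℝ) * 4 ≤ r := by
      linarith [Nat.ceil_lt_add_one (by linarith : 0 ≤ r / 6)]
    have h2 : ((⌈r / 6⌉₊ : ℝ) * 4) ^ d ≤ r ^ d := pow_le_pow_left₀ (by positivity) h1 d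
    rw [hrd, mul_pow] at h2
    exact_mod_cast h2
  · linarith [Nat.le_ceil (r / 6)]

theorem two_mul_le_four_pow (d : ℕ) : 2 * d ≤ 4 ^ d := by
  induction d with
  | zero => simp
  | succ d ih =>
    have : 1 ≤ 4 ^ d := Nat.one_le_pow _ _ (by norm_num)
    rw [pow_succ]; omega

theorem abs_clamp_sub_le {a b : ℝ} (hb : b ∈ Set.Icc (0 : ℝ) 1) :
    |max (min a 1) 0 - b| ≤ |a - b| := by
  have h : max (min b 1) 0 = b := by rw [min_eq_left hb.2, max_eq_left hb.1]
  calc |max (min a 1) 0 - b| = |max (min a 1) 0 - max (min b 1) 0| := by rw [h]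
    _ ≤ _ := (abs_max_sub_max_le_abs _ _ _).trans (abs_inf_sub_inf_le_abs _ _ _)

/-- The function `E` is approximated by `max_p (E (t_p) - c ‖x - t_p‖₁)`, the smallest `c`-Lipschitz
function that agrees with `E` at the grid points `t_p`. -/
theorem exists_abs_realization_sub_le {d D L : ℕ} {l : ℕ → ℕ} (h0 : l 0 = d) (hL : l L = 1)
    (hLpos : 0 < L) (hl : ∀ i ≤ L, 0 < l i) (hD : numParams l L ≤ D) {c : ℝ} (hc : 2 ≤ c)
    (E : Cube d → unitInterval)
    (hE : ∀ x y : Cube d,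
      |(E x : ℝ) - (E y : ℝ)| ≤ c * ∑ i : Fin d, |(x : Fin d → ℝ) i - (y : Fin d → ℝ) i|) :
    ∃ θ : Fin D → ℝ, ‖θ‖ ≤ c ∧ ∀ x : Cube d, |realization h0 hL θ x - (E x : ℝ)| ≤
      6 * (d : ℝ) * c / (minWidth l L : ℝ) ^ (1 / (d : ℝ)) := by
  have hd : 0 < d := h0 ▸ hl 0 (Nat.zero_le _)
  have hr0 : 0 < (minWidth l L : ℝ) ^ (1 / (d : ℝ)) :=
    Real.rpow_pos_of_pos (by exact_mod_cast minWidth_pos hl) _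
  rcases le_or_gt ((minWidth l L : ℝ) ^ (1 / (d : ℝ))) (6 * d * c) with hsmall | hbig
  · -- the bound is at least `1`
    refine ⟨0, by simpa using (by linarith : 0 ≤ c), fun x => ?_⟩
    exact (abs_sub_le_one (realization_mem_Icc h0 hL hLpos _ _) (E x).2).trans
      ((one_le_div hr0).2 hsmall)
  obtain ⟨n, hn, hnW, hn6⟩ := exists_grid_size hd hc hbig
  subst h0
  have hcard : Fintype.card (Fin (l 0) → Fin n) = n ^ l 0 := by simp
  let σ := (Fintype.equivFinOfCardEq hcard).symm
  have hpos : 0 < n ^ l 0 := by positivity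
  have : Nonempty (Fin (n ^ l 0)) := ⟨⟨0, hpos⟩⟩
  let t : Fin (n ^ l 0) → Cube (l 0) := fun p => ⟨fun i => midpoint01 n (σ p i),
    fun i => (midpoint01_mem _).1, fun i => (midpoint01_mem _).2⟩
  let F : (Fin (l 0) → ℝ) → ℝ := fun x => Finset.univ.sup' Finset.univ_nonempty
    fun p => (E (t p) : ℝ) - c * ∑ i, |x i - (t p : Fin (l 0) → ℝ) i|
  have hF : ∀ x, IsGreatest
      (Set.range fun p => (E (t p) : ℝ) - c * ∑ i, |x i - (t p : Fin (l 0) → ℝ) i|) (F x) := by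
    intro x
    constructor
    · obtain ⟨p, -, hp⟩ := Finset.exists_mem_eq_sup' Finset.univ_nonempty
        fun p => (E (t p) : ℝ) - c * ∑ i, |x i - (t p : Fin (l 0) → ℝ) i|
      exact ⟨p, hp.symm⟩
    · rintro _ ⟨p, rfl⟩
      exact Finset.le_sup' (fun p => (E (t p) : ℝ) - c * ∑ i, |x i - (t p : Fin (l 0) → ℝ) i|)
        (Finset.mem_univ p)
  -- the width is at least `4 ^ l 0` times the number of grid points, and the depth suffices
  have h4 : n ^ l 0 * 4 ≤ n ^ l 0 * 4 ^ l 0 :=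
    Nat.mul_le_mul_left _ (Nat.le_self_pow hd.ne' 4)
  have hL4 : n ^ l 0 * 4 ≤ 2 ^ L := h4.trans (hnW.trans (minWidth_le_two_pow l L))
  obtain ⟨s, rfl⟩ : ∃ s, L = s + 2 := by
    refine ⟨L - 2, ?_⟩
    by_contra h
    obtain rfl : L = 1 := by omega
    omega
  have hmono := numParams_mono l
  have hone : IsMaxOfHiddenLayer l D c 1 (n ^ l 0) F := by
    refine isMaxOfHiddenLayer_one (by linarith) ((hmono (by omega)).trans hD) ?_
      (fun p => t p) (fun p i => midpoint01_mem _) (fun p => E (t p)) (fun p => (E (t p)).2) hF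
    calc n ^ l 0 * (l 0 * 2) ≤ n ^ l 0 * 4 ^ l 0 :=
          Nat.mul_le_mul_left _ (by rw [mul_comm]; exact two_mul_le_four_pow _)
      _ ≤ _ := hnW.trans (minWidth_le le_rfl (by omega))
  have hmax : IsMaxOfHiddenLayer l D c (1 + s) 1 F :=
    hone.add (by linarith) hpos (by rw [pow_add] at hL4; omega) ((hmono (by omega)).trans hD)
      fun i hi hi' => by
        have := hnW.trans (minWidth_le (l := l) (L := s + 2) (i := i) (by omega) (by omega))
        omega
  rw [add_comm] at hmax
  obtain ⟨θ, hθ, hnet⟩ := hmax.exists_net_eq (by simpa [add_assoc] using hD)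
  refine ⟨θ, hθ, fun x => ?_⟩
  have hre : realization rfl hL θ (x : Fin (l 0) → ℝ) = max (min (F x) 1) 0 := hnet _ _
  rw [hre]
  refine (abs_clamp_sub_le (E x).2).trans ?_
  have hn' : (0 : ℝ) < n := by exact_mod_cast hn
  have hc0 : 0 < c := by linarith
  have hFle : F x ≤ E x := by
    obtain ⟨⟨p, hp⟩, -⟩ := hF x
    rw [← hp]
    have := (abs_le.1 (hE x (t p))).1
    dsimp only
    linarith
  obtain ⟨p, hp⟩ : ∃ p, ∀ i, |(x : Fin (l 0) → ℝ) i - (t p : Fin (l 0) → ℝ) i| ≤ 1 / (2 * n) := by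
    choose q hq using fun i => exists_abs_sub_midpoint01_le hn
      (y := (x : Fin (l 0) → ℝ) i) ⟨x.2.1 i, x.2.2 i⟩
    exact ⟨σ.symm q, fun i => by simpa [t] using hq i⟩
  have hsum : ∑ i, |(x : Fin (l 0) → ℝ) i - (t p : Fin (l 0) → ℝ) i| ≤ l 0 * (1 / (2 * n)) := by
    simpa using Finset.sum_le_card_nsmul Finset.univ _ _ fun i _ => hp i
  have hleF := (hF x).2 ⟨p, rfl⟩
  dsimp only at hleF
  have hEt := (abs_le.1 (hE x (t p))).2
  have hcs := mul_le_mul_of_nonneg_left hsum hc0.le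
  have h2 : c * (l 0 * (1 / (2 * n))) * 2 = l 0 * c / n := by field_simp
  have h3 : (l 0 : ℝ) * c / n ≤ 6 * l 0 * c / (minWidth l (s + 2) : ℝ) ^ (1 / (l 0 : ℝ)) := by
    rw [div_le_div_iff₀ hn' hr0]
    have : 0 ≤ (l 0 : ℝ) * c := by positivity
    nlinarith
  rw [abs_of_nonpos (by linarith)]
  linarith

/-! ### The best of several independent random initializations -/

theorem integral_le_inv_of_measure_lt_le {Ω : Type*} [MeasurableSpace Ω] {P : Measure Ω}
    [IsProbabilityMeasure P] {W : Ω → ℝ} (hW : Measurable W) (h0 : ∀ ω, 0 ≤ W ω)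
    (h1 : ∀ᵐ ω ∂P, W ω ≤ 1) {K : ℕ}
    (h : ∀ t ∈ Set.Ioc (0 : ℝ) 1, P.real {ω | t < W ω} ≤ (1 - t) ^ K) :
    ∫ ω, W ω ∂P ≤ 1 / (K + 1) := by
  have hint : Integrable W P :=
    Integrable.of_mem_Icc 0 1 hW.aemeasurable (h1.mono fun ω hω => ⟨h0 ω, hω⟩)
  rw [hint.integral_eq_integral_meas_lt (ae_of_all _ h0)]
  have hzero : ∀ t ∈ Set.Ioi (0 : ℝ) \ Set.Ioc 0 1, P.real {ω | t < W ω} = 0 := by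
    rintro t ⟨ht0, ht⟩
    have ht1 : 1 < t := by
      by_contra h'
      exact ht ⟨ht0, not_lt.1 h'⟩
    rw [measureReal_eq_zero_iff, measure_eq_zero_iff_ae_notMem]
    filter_upwards [h1] with ω hω
    simp only [not_lt]
    linarith
  rw [setIntegral_eq_of_subset_of_forall_sdiff_eq_zero measurableSet_Ioi
    (fun t ht => ht.1 : Set.Ioc (0 : ℝ) 1 ⊆ Set.Ioi 0) hzero]
  have hcont : Continuous fun t : ℝ => (1 - t) ^ K := by fun_prop
  calc ∫ t in Set.Ioc (0 : ℝ) 1, P.real {ω | t < W ω} ≤ ∫ t in Set.Ioc (0 : ℝ) 1, (1 - t) ^ K := by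
        refine integral_mono_of_nonneg (ae_of_all _ fun _ => measureReal_nonneg) ?_ ?_
        · exact (hcont.integrableOn_Icc (a := 0) (b := 1)).mono_set Set.Ioc_subset_Icc_self
        · exact (ae_restrict_mem measurableSet_Ioc).mono h
    _ = ∫ t in (0 : ℝ)..1, (1 - t) ^ K := (intervalIntegral.integral_of_le zero_le_one).symm
    _ = 1 / (K + 1) := by
        rw [intervalIntegral.integral_comp_sub_left (fun t => t ^ K)]
        simp

/-- The maximum distance of the first `p` coordinates. -/
noncomputable def headDist {D : ℕ} (p : ℕ) (θ ϑ : Fin D → ℝ) : ℝ :=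
  ‖fun i : Fin p => param θ i - param ϑ i‖

theorem measurable_param {D : ℕ} (k : ℕ) : Measurable fun θ : Fin D → ℝ => param θ k := by
  unfold param
  split_ifs with h
  · exact measurable_pi_apply _
  · exact measurable_const

theorem measurable_headDist {D : ℕ} (p : ℕ) (ϑ : Fin D → ℝ) :
    Measurable fun θ => headDist p θ ϑ :=
  (measurable_pi_lambda _ fun _ => (measurable_param _).sub_const _).norm

theorem abs_param_sub_le_headDist {D p k : ℕ} (hk : k < p) (θ ϑ : Fin D → ℝ) :
    |param θ k - param ϑ k| ≤ headDist p θ ϑ :=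
  norm_le_pi_norm (fun i : Fin p => param θ i - param ϑ i) ⟨k, hk⟩

theorem headDist_le {D p : ℕ} {θ ϑ : Fin D → ℝ} {c : ℝ} (hθ : ‖θ‖ ≤ c) (hϑ : ‖ϑ‖ ≤ c) :
    headDist p θ ϑ ≤ 2 * c := by
  have hc : 0 ≤ c := (norm_nonneg _).trans hθ
  refine (pi_norm_le_iff_of_nonneg (by linarith)).2 fun i => ?_
  have := abs_sub (param θ i) (param ϑ i)
  rw [Real.norm_eq_abs]
  linarith [abs_param_le hθ i, abs_param_le hϑ i]

theorem mem_Icc_const_iff_norm_le {D : ℕ} {θ : Fin D → ℝ} {c : ℝ} (hc : 0 ≤ c) :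
    θ ∈ Set.Icc (fun _ => -c) (fun _ : Fin D => c) ↔ ‖θ‖ ≤ c := by
  rw [pi_norm_le_iff_of_nonneg hc]
  simp only [Set.mem_Icc, Pi.le_def, Real.norm_eq_abs, abs_le, forall_and]

section Uniform

variable {Ω : Type*} [MeasurableSpace Ω] {P : Measure Ω} {D : ℕ} {c : ℝ} {Θ : Ω → Fin D → ℝ}

theorem volume_cube_eq (D : ℕ) (c : ℝ) :
    volume (Set.Icc (fun _ => -c) (fun _ : Fin D => c)) = ENNReal.ofReal (2 * c) ^ D := by
  rw [Real.volume_Icc_pi]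
  simp [← two_mul]

theorem measure_preimage_of_isUniform (hc : 0 < c)
    (hΘ : pdf.IsUniform Θ (Set.Icc (fun _ => -c) (fun _ => c)) P volume)
    {A : Set (Fin D → ℝ)} (hA : MeasurableSet A) :
    P (Θ ⁻¹' A) = volume (Set.Icc (fun _ => -c) (fun _ => c) ∩ A) / ENNReal.ofReal (2 * c) ^ D := by
  rw [pdf.IsUniform.measure_preimage _ _ hΘ hA, volume_cube_eq]
  · rw [volume_cube_eq]; simp [hc]
  · rw [volume_cube_eq]; exact ENNReal.pow_ne_top ENNReal.ofReal_ne_top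

theorem ae_norm_le_of_isUniform (hc : 0 < c) (hΘm : Measurable Θ) [IsProbabilityMeasure P]
    (hΘ : pdf.IsUniform Θ (Set.Icc (fun _ => -c) (fun _ => c)) P volume) :
    ∀ᵐ ω ∂P, ‖Θ ω‖ ≤ c := by
  have h : P (Θ ⁻¹' Set.Icc (fun _ => -c) (fun _ => c)) = 1 := by
    rw [measure_preimage_of_isUniform hc hΘ measurableSet_Icc, Set.inter_self, volume_cube_eq]
    exact ENNReal.div_self (by simp [hc]) (ENNReal.pow_ne_top ENNReal.ofReal_ne_top)
  rw [← mem_ae_iff_prob_eq_one (hΘm measurableSet_Icc)] at h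
  exact Filter.mem_of_superset h fun ω hω => (mem_Icc_const_iff_norm_le hc.le).1 hω

/-- The contraction of the cube towards `ϑ` with factor `u` in the first `p` coordinates has
`u ^ p` times the volume of the cube. -/
theorem le_measure_headDist_le (hc : 0 < c)
    (hΘ : pdf.IsUniform Θ (Set.Icc (fun _ => -c) (fun _ => c)) P volume) {p : ℕ} (hp : p ≤ D)
    {ϑ : Fin D → ℝ} (hϑ : ‖ϑ‖ ≤ c) {u : ℝ} (hu : u ∈ Set.Icc (0 : ℝ) 1) :
    ENNReal.ofReal (u ^ p) ≤ P {ω | headDist p (Θ ω) ϑ ≤ 2 * c * u} := by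
  have hA : MeasurableSet {θ : Fin D → ℝ | headDist p θ ϑ ≤ 2 * c * u} :=
    measurableSet_le (measurable_headDist p ϑ) measurable_const
  have hmeas := measure_preimage_of_isUniform hc hΘ hA
  change _ ≤ P (Θ ⁻¹' {θ : Fin D → ℝ | headDist p θ ϑ ≤ 2 * c * u})
  rw [hmeas, ENNReal.le_div_iff_mul_le (by simp [hc])
    (Or.inl (ENNReal.pow_ne_top ENNReal.ofReal_ne_top))]
  let v : Fin D → ℝ := fun i => if (i : ℕ) < p then u else 1
  have hv : ∀ i, v i ∈ Set.Icc (0 : ℝ) 1 := fun i => by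
    simp only [v]; split_ifs
    · exact hu
    · simp
  have hvol : volume (Set.Icc (fun i => ϑ i - v i * (ϑ i + c)) (fun i => ϑ i + v i * (c - ϑ i))) =
      ENNReal.ofReal (u ^ p) * ENNReal.ofReal (2 * c) ^ D := by
    rw [Real.volume_Icc_pi]
    have : ∀ i, ϑ i + v i * (c - ϑ i) - (ϑ i - v i * (ϑ i + c)) = v i * (2 * c) := fun i => by ring
    simp only [this, ENNReal.ofReal_mul (hv _).1, Finset.prod_mul_distrib, Finset.prod_const,
      Finset.card_univ, Fintype.card_fin]
    congr 1
    have : ∀ i, ENNReal.ofReal (v i) = if (i : ℕ) < p then ENNReal.ofReal u else 1 := fun i => by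
      simp only [v]; split_ifs <;> simp
    simp only [this]
    rw [Finset.prod_ite, Finset.prod_const, Finset.prod_const_one, mul_one,
      ENNReal.ofReal_pow hu.1, Fin.card_filter_val_lt, min_eq_right hp]
  rw [← hvol]
  refine measure_mono fun θ hθ => ?_
  have habs : ∀ i, |ϑ i| ≤ c := fun i => (norm_le_pi_norm ϑ i).trans hϑ
  have h1 : ∀ i, ϑ i - v i * (ϑ i + c) ≤ θ i := hθ.1
  have h2 : ∀ i, θ i ≤ ϑ i + v i * (c - ϑ i) := hθ.2
  refine ⟨⟨fun i => ?_, fun i => ?_⟩, (pi_norm_le_iff_of_nonneg (by have := hu.1; positivity)).2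
    fun i => ?_⟩
  · have := abs_le.1 (habs i)
    have := hv i
    dsimp only
    nlinarith [h1 i, this.2]
  · have := abs_le.1 (habs i)
    have := hv i
    dsimp only
    nlinarith [h2 i, this.2]
  · have hi : (i : ℕ) < D := i.2.trans_le hp
    have := abs_le.1 (habs ⟨i, hi⟩)
    have e1 := h1 ⟨i, hi⟩
    have e2 := h2 ⟨i, hi⟩
    simp only [v, i.2, if_true] at e1 e2
    simp only [param, hi, dif_pos, Real.norm_eq_abs]
    have := hu.1
    exact abs_le.2 ⟨by nlinarith, by nlinarith⟩

theorem measure_lt_headDist_le (hc : 0 < c) (hΘm : Measurable Θ) [IsProbabilityMeasure P]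
    (hΘ : pdf.IsUniform Θ (Set.Icc (fun _ => -c) (fun _ => c)) P volume) {p : ℕ} (hp : p ≤ D)
    {ϑ : Fin D → ℝ} (hϑ : ‖ϑ‖ ≤ c) {u : ℝ} (hu : u ∈ Set.Icc (0 : ℝ) 1) :
    P.real {ω | 2 * c * u < headDist p (Θ ω) ϑ} ≤ 1 - u ^ p := by
  have h := le_measure_headDist_le hc hΘ hp hϑ hu
  have hA : MeasurableSet {ω | headDist p (Θ ω) ϑ ≤ 2 * c * u} :=
    measurableSet_le ((measurable_headDist p ϑ).comp hΘm) measurable_const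
  have hcompl : {ω | 2 * c * u < headDist p (Θ ω) ϑ} = {ω | headDist p (Θ ω) ϑ ≤ 2 * c * u}ᶜ := by
    ext; simp
  rw [hcompl, probReal_compl_eq_one_sub hA]
  have := (ENNReal.ofReal_le_iff_le_toReal (measure_ne_top _ _)).1 h
  exact sub_le_sub_left this 1

end Uniform

/-- Let `V` be the distance to `ϑ` of the best initialization, divided by `2 c`. Then
`ℙ(V ^ p > t) ≤ (1 - t) ^ K`, hence `𝔼[V ^ p] ≤ 1 / (K + 1)`, and Jensen's inequality yields the
bound for `𝔼[V]`. -/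
theorem integral_inf_headDist_le {Ω ι : Type*} [MeasurableSpace Ω] {P : Measure Ω}
    [IsProbabilityMeasure P] [Fintype ι] [Nonempty ι] {D : ℕ} {c : ℝ} {Θ : ι → Ω → Fin D → ℝ}
    (hc : 0 < c) (hΘm : ∀ k, Measurable (Θ k)) (hind : iIndepFun Θ P)
    (hΘ : ∀ k, pdf.IsUniform (Θ k) (Set.Icc (fun _ => -c) (fun _ => c)) P volume)
    {p : ℕ} (hp0 : 0 < p) (hp : p ≤ D) {ϑ : Fin D → ℝ} (hϑ : ‖ϑ‖ ≤ c) :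
    Integrable (fun ω => Finset.univ.inf' Finset.univ_nonempty
      fun k => headDist p (Θ k ω) ϑ) P ∧
    ∫ ω, Finset.univ.inf' Finset.univ_nonempty (fun k => headDist p (Θ k ω) ϑ) ∂P ≤
      2 * c / (Fintype.card ι : ℝ) ^ (1 / (p : ℝ)) := by
  set I : Ω → ℝ := fun ω => Finset.univ.inf' Finset.univ_nonempty
      fun k => headDist p (Θ k ω) ϑ with hI
  have hIm : Measurable I := by
    have : I = Finset.univ.inf' Finset.univ_nonempty fun k ω => headDist p (Θ k ω) ϑ :=
      funext fun ω => by rw [Finset.inf'_apply]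
    rw [this]
    exact Finset.inf'_induction (p := Measurable) _ _ (fun _ ha _ hb => ha.inf hb)
      fun k _ => (measurable_headDist p ϑ).comp (hΘm k)
  have hI0 : ∀ ω, 0 ≤ I ω := fun ω => Finset.le_inf' _ _ fun k _ => norm_nonneg _
  have hI2 : ∀ᵐ ω ∂P, I ω ≤ 2 * c := by
    obtain ⟨k⟩ := ‹Nonempty ι›
    filter_upwards [ae_norm_le_of_isUniform hc (hΘm k) (hΘ k)] with ω hω
    exact (Finset.inf'_le _ (Finset.mem_univ k)).trans (headDist_le hω hϑ)
  have hIint : Integrable I P :=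
    Integrable.of_mem_Icc 0 (2 * c) hIm.aemeasurable (hI2.mono fun ω hω => ⟨hI0 ω, hω⟩)
  refine ⟨hIint, ?_⟩
  let V : Ω → ℝ := fun ω => I ω / (2 * c)
  have hVm : Measurable V := hIm.div_const _
  have hV0 : ∀ ω, 0 ≤ V ω := fun ω => div_nonneg (hI0 ω) (by linarith)
  have hV1 : ∀ᵐ ω ∂P, V ω ≤ 1 := hI2.mono fun ω hω => div_le_one_of_le₀ hω (by linarith)
  have htail : ∀ u ∈ Set.Icc (0 : ℝ) 1,
      P.real {ω | u < V ω} ≤ (1 - u ^ p) ^ Fintype.card ι := fun u hu => by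
    have hset : {ω | u < V ω} = ⋂ k ∈ (Finset.univ : Finset ι),
        Θ k ⁻¹' {θ | 2 * c * u < headDist p θ ϑ} := by
      ext ω
      simp only [Set.mem_ofPred_eq, V, lt_div_iff₀ (by linarith : 0 < 2 * c), hI,
        Finset.lt_inf'_iff, Finset.mem_univ, Set.mem_iInter, Set.mem_preimage, true_implies,
        mul_comm u]
    have hprod := hind.measure_inter_preimage_eq_mul Finset.univ
      (sets := fun _ => {θ | 2 * c * u < headDist p θ ϑ})
      fun _ _ => measurableSet_lt measurable_const (measurable_headDist p ϑ)
    rw [hset, measureReal_def, hprod, ENNReal.toReal_prod, ← Finset.card_univ]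
    refine (Finset.prod_le_prod (fun _ _ => ENNReal.toReal_nonneg) fun k _ =>
      measure_lt_headDist_le hc (hΘm k) (hΘ k) hp hϑ hu).trans_eq (Finset.prod_const _)
  have hmoment : ∫ ω, V ω ^ p ∂P ≤ 1 / (Fintype.card ι + 1) := by
    refine integral_le_inv_of_measure_lt_le (hVm.pow_const p) (fun ω => pow_nonneg (hV0 ω) p)
      (hV1.mono fun ω hω => pow_le_one₀ (hV0 ω) hω) fun t ht => ?_
    have hroot : (t ^ (1 / (p : ℝ))) ^ p = t := by
      rw [one_div, Real.rpow_inv_natCast_pow ht.1.le hp0.ne']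
    have hmem : t ^ (1 / (p : ℝ)) ∈ Set.Icc (0 : ℝ) 1 :=
      ⟨Real.rpow_nonneg ht.1.le _, Real.rpow_le_one ht.1.le ht.2 (by positivity)⟩
    have := htail _ hmem
    rw [hroot] at this
    refine le_trans (measureReal_mono fun ω hω => ?_) this
    by_contra hcon
    have := pow_le_pow_left₀ (hV0 ω) (not_lt.1 hcon) p
    rw [hroot] at this
    exact absurd hω (not_lt.2 this)
  have hVint : Integrable V P := hIint.div_const _
  have hjensen : (∫ ω, V ω ∂P) ^ p ≤ ∫ ω, V ω ^ p ∂P :=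
    (convexOn_pow p).map_integral_le (continuous_pow p).continuousOn isClosed_Ici
      (ae_of_all _ hV0) hVint (Integrable.of_mem_Icc 0 1 (hVm.pow_const p).aemeasurable
        (hV1.mono fun ω hω => ⟨pow_nonneg (hV0 ω) p, pow_le_one₀ (hV0 ω) hω⟩))
  have hcard : (0 : ℝ) < Fintype.card ι := by exact_mod_cast Fintype.card_pos
  have hVI : ∫ ω, I ω ∂P = 2 * c * ∫ ω, V ω ∂P := by
    rw [integral_div, mul_div_cancel₀ _ (by linarith)]
  rw [hVI, div_eq_mul_inv]
  refine mul_le_mul_of_nonneg_left ?_ (by linarith)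
  refine le_of_pow_le_pow_left₀ hp0.ne' (by positivity) (hjensen.trans (hmoment.trans ?_))
  rw [inv_pow, one_div (p : ℝ), Real.rpow_inv_natCast_pow hcard.le hp0.ne', ← one_div]
  exact one_div_le_one_div_of_le hcard (by linarith)

/-! ### Uniform deviation of the empirical risk -/

/-- Hoeffding's inequality, two-sided, for the empirical mean of a `[0,1]`-valued function. -/
theorem measure_le_abs_empirical_sub_le {Ω S : Type*} [MeasurableSpace Ω] [MeasurableSpace S]
    {P : Measure Ω} [IsProbabilityMeasure P] {M : ℕ} (hM : 0 < M) {X : Fin M → Ω → S}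
    (hX : ∀ j, Measurable (X j)) (hind : iIndepFun X P)
    (hident : ∀ j, IdentDistrib (X j) (X ⟨0, hM⟩) P P) {f : S → ℝ} (hf : Measurable f)
    (hf01 : ∀ x, f x ∈ Set.Icc (0 : ℝ) 1) {t : ℝ} (ht : 0 ≤ t) :
    P.real {ω | t ≤ |1 / (M : ℝ) * ∑ j, f (X j ω) - ∫ x, f x ∂(P.map (X ⟨0, hM⟩))|} ≤
      2 * Real.exp (-(2 * M * t ^ 2)) := by
  set μ := ∫ x, f x ∂(P.map (X ⟨0, hM⟩)) with hμ
  have hM' : (0 : ℝ) < M := by exact_mod_cast hM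
  let Y : Fin M → Ω → ℝ := fun j ω => f (X j ω) - μ
  have hmean : ∀ j, ∫ ω, f (X j ω) ∂P = μ := fun j => by
    rw [hμ, ← (hident j).map_eq, integral_map (hX j).aemeasurable hf.aestronglyMeasurable]
  have hYind : iIndepFun Y P := hind.comp (fun _ x => f x - μ) fun _ => hf.sub_const _
  have hYind' : iIndepFun (fun j => -Y j) P :=
    hind.comp (fun _ x => -(f x - μ)) fun _ => (hf.sub_const _).neg
  have hsub : ∀ j, HasSubgaussianMGF (Y j) ((‖(1 : ℝ) - 0‖₊ / 2) ^ 2) P := fun j => by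
    have := hasSubgaussianMGF_of_mem_Icc (μ := P) (X := fun ω => f (X j ω)) (a := 0) (b := 1)
      (hf.comp (hX j)).aemeasurable (ae_of_all _ fun ω => hf01 _)
    rwa [hmean j] at this
  have hexp : -(M * t) ^ 2 /
      (2 * ((∑ _j : Fin M, (‖(1 : ℝ) - 0‖₊ / 2) ^ 2 : NNReal) : ℝ)) = -(2 * M * t ^ 2) := by
    simp
    field_simp
  have h1 := HasSubgaussianMGF.measure_sum_ge_le_of_iIndepFun hYind (s := Finset.univ)
    (fun j _ => hsub j) (ε := M * t) (by positivity)
  have h2 := HasSubgaussianMGF.measure_sum_ge_le_of_iIndepFun hYind' (s := Finset.univ)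
    (fun j _ => (hsub j).neg) (ε := M * t) (by positivity)
  rw [hexp] at h1 h2
  have hsum : ∀ ω, ∑ j, Y j ω = M * (1 / (M : ℝ) * ∑ j, f (X j ω) - μ) := fun ω => by
    simp only [Y, Finset.sum_sub_distrib, Finset.sum_const, Finset.card_univ, Fintype.card_fin,
      nsmul_eq_mul]
    field_simp
  rw [two_mul]
  refine (measureReal_mono ?_).trans ((measureReal_union_le _ _).trans (add_le_add h1 h2))
  intro ω hω
  rcases le_abs.1 (show t ≤ |_| from hω) with h | h
  · left
    change M * t ≤ ∑ j, Y j ω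
    rw [hsum]
    exact mul_le_mul_of_nonneg_left h hM'.le
  · right
    change M * t ≤ ∑ j, -Y j ω
    rw [Finset.sum_neg_distrib, hsum, ← mul_neg]
    exact mul_le_mul_of_nonneg_left h hM'.le

/-- The grid of parameter vectors whose first `p` coordinates are midpoints of `n` equal
subintervals of `[-c, c]`, and whose other coordinates vanish. -/
noncomputable def paramGrid (D : ℕ) (c : ℝ) {p n : ℕ} (a : Fin p → Fin n) : Fin D → ℝ := fun i =>
  if h : (i : ℕ) < p then c * (2 * midpoint01 n (a ⟨i, h⟩) - 1) else 0

theorem norm_paramGrid_le {D p n : ℕ} {c : ℝ} (hc : 0 ≤ c) (a : Fin p → Fin n) :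
    ‖paramGrid D c a‖ ≤ c := by
  refine (pi_norm_le_iff_of_nonneg hc).2 fun i => ?_
  unfold paramGrid
  split_ifs with h
  · have := midpoint01_mem (a ⟨i, h⟩)
    rw [norm_mul, Real.norm_of_nonneg hc]
    exact mul_le_of_le_one_right hc (abs_le.2 ⟨by linarith [this.1], by linarith [this.2]⟩)
  · simpa using hc

theorem exists_headDist_paramGrid_le {D p n : ℕ} (hp : p ≤ D) (hn : 0 < n) {c : ℝ} (hc : 0 < c)
    {θ : Fin D → ℝ} (hθ : ‖θ‖ ≤ c) :
    ∃ a : Fin p → Fin n, headDist p θ (paramGrid D c a) ≤ c / n := by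
  have hn' : (0 : ℝ) < n := by exact_mod_cast hn
  have hmem : ∀ i : Fin p, (param θ i + c) / (2 * c) ∈ Set.Icc (0 : ℝ) 1 := fun i => by
    have := abs_le.1 (abs_param_le hθ i)
    exact ⟨div_nonneg (by linarith) (by linarith), div_le_one_of_le₀ (by linarith) (by linarith)⟩
  choose a ha using fun i => exists_abs_sub_midpoint01_le hn (hmem i)
  refine ⟨a, (pi_norm_le_iff_of_nonneg (by positivity)).2 fun i => ?_⟩
  have hi : (i : ℕ) < D := i.2.trans_le hp
  have h1 : param (paramGrid D c a) i = c * (2 * midpoint01 n (a i) - 1) := by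
    simp [param, paramGrid, hi]
  have h2 : param θ i - c * (2 * midpoint01 n (a i) - 1) =
      2 * c * ((param θ i + c) / (2 * c) - midpoint01 n (a i)) := by field_simp; ring
  rw [h1, h2, norm_mul, Real.norm_of_nonneg (by linarith)]
  calc 2 * c * ‖(param θ i + c) / (2 * c) - midpoint01 n (a i)‖ ≤ 2 * c * (1 / (2 * n)) := by
        gcongr; exact ha i
    _ = c / n := by field_simp

theorem measurable_affine {T : Type*} [MeasurableSpace T] {D s m n : ℕ} {θ : T → Fin D → ℝ}
    {x : T → Fin n → ℝ} (hθ : Measurable θ) (hx : Measurable x) :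
    Measurable fun τ => affine (θ τ) s m n (x τ) := by
  refine measurable_pi_lambda _ fun i => ?_
  refine Measurable.add (Finset.measurable_sum _ fun j _ => ?_) ((measurable_param _).comp hθ)
  exact ((measurable_param _).comp hθ).mul ((measurable_pi_apply j).comp hx)

theorem measurable_realization {T : Type*} [MeasurableSpace T] {d D L : ℕ} {l : ℕ → ℕ}
    (h0 : l 0 = d) (hL : l L = 1) {θ : T → Fin D → ℝ} {x : T → Fin d → ℝ} (hθ : Measurable θ)
    (hx : Measurable x) : Measurable fun τ => realization h0 hL (θ τ) (x τ) := by
  have hx' : Measurable fun τ (i : Fin (l 0)) => x τ (Fin.cast h0 i) :=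
    measurable_pi_lambda _ fun i => (measurable_pi_apply _).comp hx
  have hhidden : ∀ k, Measurable fun τ => hiddenLayer l (θ τ) (fun i => x τ (Fin.cast h0 i)) k := by
    intro k
    induction k with
    | zero => exact hx'
    | succ k ih =>
      exact measurable_pi_lambda _ fun i =>
        ((measurable_pi_apply i).comp (measurable_affine hθ ih)).max measurable_const
  have hnet : Measurable fun τ => net l (θ τ) (fun i => x τ (Fin.cast h0 i)) L := by
    cases L with
    | zero => exact hx'
    | succ k =>
      exact measurable_pi_lambda _ fun i =>
        (((measurable_pi_apply i).comp (measurable_affine hθ (hhidden k))).min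
          measurable_const).max measurable_const
  exact (measurable_pi_apply _).comp hnet

theorem measurable_of_lipschitz_sum {d : ℕ} {c : ℝ} (hc : 0 ≤ c) {E : Cube d → unitInterval}
    (hE : ∀ x y : Cube d,
      |(E x : ℝ) - (E y : ℝ)| ≤ c * ∑ i : Fin d, |(x : Fin d → ℝ) i - (y : Fin d → ℝ) i|) :
    Measurable fun x => (E x : ℝ) := by
  have : LipschitzWith (Real.toNNReal (c * d)) fun x => (E x : ℝ) :=
    LipschitzWith.of_dist_le' fun x y => by
      rw [Real.dist_eq, mul_assoc]
      refine (hE x y).trans (mul_le_mul_of_nonneg_left ?_ hc)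
      simpa using Finset.sum_le_card_nsmul Finset.univ
        (fun i : Fin d => |(x : Fin d → ℝ) i - (y : Fin d → ℝ) i|) (dist x y)
        fun i _ => dist_le_pi_dist (x : Fin d → ℝ) y i
  exact this.continuous.measurable

section Risk

variable {d D L : ℕ} {l : ℕ → ℕ} (h0 : l 0 = d) (hL : l L = 1) (E : Cube d → unitInterval)

/-- The squared error of the network at the point `x`. -/
noncomputable def sqError (θ : Fin D → ℝ) (x : Cube d) : ℝ :=
  |realization h0 hL θ x - (E x : ℝ)| ^ 2

theorem sqError_mem_Icc (hLpos : 0 < L) (θ : Fin D → ℝ) (x : Cube d) :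
    sqError h0 hL E θ x ∈ Set.Icc (0 : ℝ) 1 :=
  ⟨by unfold sqError; positivity, pow_le_one₀ (abs_nonneg _)
    (abs_sub_le_one (realization_mem_Icc h0 hL hLpos _ _) (E x).2)⟩

theorem measurable_sqError (hE : Measurable fun x => (E x : ℝ)) (θ : Fin D → ℝ) :
    Measurable (sqError h0 hL E θ) :=
  ((measurable_realization h0 hL measurable_const measurable_subtype_coe).sub hE).norm.pow_const 2

theorem abs_sqError_sub_le (hLpos : 0 < L) {θ ϑ : Fin D → ℝ} {c : ℝ} (hc : 1 ≤ c) (hθ : ‖θ‖ ≤ c)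
    (hϑ : ‖ϑ‖ ≤ c) (x : Cube d) :
    |sqError h0 hL E θ x - sqError h0 hL E ϑ x| ≤
      2 * (L * (maxWidth l L + 1) ^ L * c ^ (L - 1) * headDist (numParams l L) θ ϑ) := by
  have hLip := abs_realization_sub_le h0 hL hLpos hc hθ hϑ (le_maxWidth l L) (norm_nonneg _)
    (fun i hi => abs_param_sub_le_headDist hi θ ϑ) x
  have ha := abs_le.1 (abs_sub_le_one (realization_mem_Icc h0 hL hLpos θ x) (E x).2)
  have hb := abs_le.1 (abs_sub_le_one (realization_mem_Icc h0 hL hLpos ϑ x) (E x).2)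
  have key : sqError h0 hL E θ x - sqError h0 hL E ϑ x =
      ((realization h0 hL θ x - E x) + (realization h0 hL ϑ x - E x)) *
        (realization h0 hL θ x - realization h0 hL ϑ x) := by
    simp only [sqError, sq_abs]; ring
  rw [key, abs_mul]
  exact mul_le_mul (abs_le.2 ⟨by linarith [ha.1, hb.1], by linarith [ha.2, hb.2]⟩) hLip
    (abs_nonneg _) zero_le_two

/-- The risk of the parameter vector `θ` under the distribution `ν` of the input. -/
noncomputable def trueRisk (ν : Measure (Cube d)) (θ : Fin D → ℝ) : ℝ :=
  ∫ x, sqError h0 hL E θ x ∂ν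

theorem integrable_sqError {ν : Measure (Cube d)} [IsProbabilityMeasure ν] (hLpos : 0 < L)
    (hE : Measurable fun x => (E x : ℝ)) (θ : Fin D → ℝ) : Integrable (sqError h0 hL E θ) ν :=
  Integrable.of_mem_Icc 0 1 (measurable_sqError h0 hL E hE θ).aemeasurable
    (ae_of_all _ fun x => sqError_mem_Icc h0 hL E hLpos θ x)

theorem abs_empiricalRisk_sub_trueRisk_le {ν : Measure (Cube d)} [IsProbabilityMeasure ν]
    (hLpos : 0 < L) (hE : Measurable fun x => (E x : ℝ)) {M : ℕ} (hM : 0 < M) (ξ : Fin M → Cube d)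
    {θ ϑ : Fin D → ℝ} {c : ℝ} (hc : 1 ≤ c) (hθ : ‖θ‖ ≤ c) (hϑ : ‖ϑ‖ ≤ c) :
    |empiricalRisk h0 hL E ξ θ - trueRisk h0 hL E ν θ| ≤
      |empiricalRisk h0 hL E ξ ϑ - trueRisk h0 hL E ν ϑ| +
      4 * (L * (maxWidth l L + 1) ^ L * c ^ (L - 1) * headDist (numParams l L) θ ϑ) := by
  set β := (L * (maxWidth l L + 1) ^ L * c ^ (L - 1) * headDist (numParams l L) θ ϑ : ℝ)
  have hsq := abs_sqError_sub_le h0 hL E hLpos hc hθ hϑ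
  have hM' : (0 : ℝ) < M := by exact_mod_cast hM
  have h1 : |empiricalRisk h0 hL E ξ θ - empiricalRisk h0 hL E ξ ϑ| ≤ 2 * β := by
    change |1 / (M : ℝ) * ∑ j, sqError h0 hL E θ (ξ j) -
      1 / (M : ℝ) * ∑ j, sqError h0 hL E ϑ (ξ j)| ≤ _
    rw [← mul_sub, ← Finset.sum_sub_distrib, abs_mul, abs_of_pos (by positivity), one_div,
      inv_mul_le_iff₀ hM']
    refine (Finset.abs_sum_le_sum_abs _ _).trans ?_
    simpa using Finset.sum_le_card_nsmul Finset.univ _ _ fun j _ => hsq (ξ j)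
  have h2 : |trueRisk h0 hL E ν θ - trueRisk h0 hL E ν ϑ| ≤ 2 * β := by
    unfold trueRisk
    rw [← integral_sub (integrable_sqError h0 hL E hLpos hE θ)
      (integrable_sqError h0 hL E hLpos hE ϑ)]
    simpa using norm_integral_le_of_norm_le_const (μ := ν)
      (f := fun x => sqError h0 hL E θ x - sqError h0 hL E ϑ x) (ae_of_all _ hsq)
  rw [abs_le] at h1 h2
  have h3 := le_abs_self (empiricalRisk h0 hL E ξ ϑ - trueRisk h0 hL E ν ϑ)
  have h4 := neg_abs_le (empiricalRisk h0 hL E ξ ϑ - trueRisk h0 hL E ν ϑ)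
  exact abs_le.2 ⟨by linarith, by linarith⟩

/-- By Hoeffding's inequality at the points of a grid and the Lipschitz continuity of the risks, the
empirical risk is uniformly close to the true risk outside an event of small probability. -/
theorem exists_measurableSet_abs_risk_sub_le {Ω : Type*} [MeasurableSpace Ω] {P : Measure Ω}
    [IsProbabilityMeasure P] {M : ℕ} (hM : 0 < M) {X : Fin M → Ω → Cube d}
    (hX : ∀ j, Measurable (X j)) (hind : iIndepFun X P)
    (hident : ∀ j, IdentDistrib (X j) (X ⟨0, hM⟩) P P) (hLpos : 0 < L)
    (hE : Measurable fun x => (E x : ℝ)) (hD : numParams l L ≤ D) {c : ℝ} (hc : 1 ≤ c) {n : ℕ}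
    (hn : 0 < n) {t : ℝ} (ht : 0 ≤ t) :
    ∃ A : Set Ω, MeasurableSet A ∧
      P.real A ≤ n ^ numParams l L * (2 * Real.exp (-(2 * M * t ^ 2))) ∧
      ∀ ω ∉ A, ∀ θ : Fin D → ℝ, ‖θ‖ ≤ c →
        |empiricalRisk h0 hL E (fun j => X j ω) θ - trueRisk h0 hL E (P.map (X ⟨0, hM⟩)) θ| ≤
          t + 4 * (L * (maxWidth l L + 1) ^ L * c ^ (L - 1) * (c / n)) := by
  have : IsProbabilityMeasure (P.map (X ⟨0, hM⟩)) :=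
    Measure.isProbabilityMeasure_map (hX _).aemeasurable
  let B : (Fin (numParams l L) → Fin n) → Set Ω := fun a =>
    {ω | t ≤ |1 / (M : ℝ) * ∑ j, sqError h0 hL E (paramGrid D c a) (X j ω) -
      ∫ x, sqError h0 hL E (paramGrid D c a) x ∂(P.map (X ⟨0, hM⟩))|}
  have hBm : ∀ a, MeasurableSet (B a) := fun a =>
    measurableSet_le measurable_const (((Finset.measurable_sum _ fun j _ =>
      (measurable_sqError h0 hL E hE _).comp (hX j)).const_mul _).sub_const _).norm
  refine ⟨⋃ a, B a, MeasurableSet.iUnion hBm, ?_, fun ω hω θ hθ => ?_⟩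
  · refine (measureReal_iUnion_fintype_le _).trans ?_
    refine (Finset.sum_le_card_nsmul _ _ _ fun a _ => measure_le_abs_empirical_sub_le hM hX hind
      hident (measurable_sqError h0 hL E hE _) (sqError_mem_Icc h0 hL E hLpos _) ht).trans ?_
    simp
  · obtain ⟨a, ha⟩ := exists_headDist_paramGrid_le hD hn (by linarith) hθ
    refine (abs_empiricalRisk_sub_trueRisk_le h0 hL E hLpos hE hM _ hc hθ
      (norm_paramGrid_le (by linarith) a)).trans (add_le_add ?_ (by gcongr))
    have : ω ∉ B a := fun h => hω (Set.mem_iUnion.2 ⟨a, h⟩)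
    exact (not_le.1 this).le

end Risk

/-! ### The overall error -/

theorem integral_abs_sub_sq_le_trueRisk {d D L : ℕ} {l : ℕ → ℕ} (h0 : l 0 = d) (hL : l L = 1)
    (E : Cube d → unitInterval) {ν : Measure (Cube d)} [IsProbabilityMeasure ν] (hLpos : 0 < L)
    (hE : Measurable fun x => (E x : ℝ)) (θ : Fin D → ℝ) :
    (∫ x : Cube d, |realization h0 hL θ x - (E x : ℝ)| ∂ν) ^ 2 ≤ trueRisk h0 hL E ν θ := by
  have hm : Measurable fun x : Cube d => |realization h0 hL θ x - (E x : ℝ)| :=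
    ((measurable_realization h0 hL measurable_const measurable_subtype_coe).sub hE).norm
  exact (even_two.convexOn_pow (𝕜 := ℝ)).map_integral_le (continuous_pow 2).continuousOn isClosed_univ
    (ae_of_all _ fun _ => Set.mem_univ _)
    (Integrable.of_mem_Icc 0 1 hm.aemeasurable (ae_of_all _ fun x => ⟨abs_nonneg _,
      abs_sub_le_one (realization_mem_Icc h0 hL hLpos _ _) (E x).2⟩))
    (integrable_sqError h0 hL E hLpos hE θ)

theorem trueRisk_le_sq {d D L : ℕ} {l : ℕ → ℕ} (h0 : l 0 = d) (hL : l L = 1)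
    (E : Cube d → unitInterval) {ν : Measure (Cube d)} [IsProbabilityMeasure ν] (hLpos : 0 < L)
    (hE : Measurable fun x => (E x : ℝ)) {θ : Fin D → ℝ} {b : ℝ}
    (hb : ∀ x : Cube d, |realization h0 hL θ x - (E x : ℝ)| ≤ b) :
    trueRisk h0 hL E ν θ ≤ b ^ 2 := by
  have := integral_mono (μ := ν) (integrable_sqError h0 hL E hLpos hE θ) (integrable_const (b ^ 2))
    fun x => pow_le_pow_left₀ (abs_nonneg _) (hb x) 2
  simpa [trueRisk] using this

theorem le_add_sqrt_of_sq_le {a b η : ℝ} (hb : 0 ≤ b) (hη : 0 ≤ η) (h : a ^ 2 ≤ b ^ 2 + η) :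
    a ≤ b + √η := by
  refine le_of_pow_le_pow_left₀ two_ne_zero (by positivity) ?_
  nlinarith [Real.sq_sqrt hη, Real.sqrt_nonneg η, mul_nonneg hb (Real.sqrt_nonneg η)]

/-- Here `y` stands for `‖l‖_∞ + 1`, and `n` is the number of grid points per parameter. -/
theorem log_mesh_le {L M : ℕ} (hL : 0 < L) (hM : 0 < M) {c y n : ℝ} (hc : 2 ≤ c)
    (hy : 2 ≤ y) (hn0 : 0 < n) (hn : n ≤ 8 * (L * y ^ L * c ^ L) * √(M : ℝ)) :
    Real.log n ≤ 4 * (L * c * y * (1 + Real.log M)) := by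
  have hL1 : (1 : ℝ) ≤ L := by exact_mod_cast hL
  have hM1 : (1 : ℝ) ≤ M := by exact_mod_cast hM
  have hc0 : 0 < c := by linarith
  have hy0 : 0 < y := by linarith
  have hlM := Real.log_nonneg hM1
  set a := 1 + Real.log M with ha
  have ha1 : 1 ≤ a := by linarith
  have h8 : Real.log 8 ≤ 7 := by
    linarith [Real.log_le_sub_one_of_pos (by norm_num : (0 : ℝ) < 8)]
  have hlog : Real.log (8 * (L * y ^ L * c ^ L) * √(M : ℝ)) = Real.log 8 + (Real.log L +
      L * Real.log y + L * Real.log c) + Real.log M / 2 := by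
    rw [Real.log_mul (by positivity) (by positivity), Real.log_mul (by positivity) (by positivity),
      Real.log_sqrt (by linarith), Real.log_mul (by positivity) (by positivity),
      Real.log_mul (by positivity) (by positivity), Real.log_pow, Real.log_pow]
  have h1 : L * Real.log y ≤ L * y := by gcongr; exact Real.log_le_self hy0.le
  have h2 : L * Real.log c ≤ L * c := by gcongr; exact Real.log_le_self hc0.le
  have h3 : Real.log L ≤ L := Real.log_le_self (by linarith)
  have hca : 2 ≤ c * a := by nlinarith
  have hya : 2 ≤ y * a := by nlinarith
  have hcy : 4 ≤ c * y := by nlinarith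
  have hcya : 4 ≤ c * y * a := hcy.trans (le_mul_of_one_le_right (by linarith) ha1)
  have hLcy : 4 ≤ L * (c * y) := hcy.trans (le_mul_of_one_le_left (by positivity) hL1)
  have e1 : L * y * 2 ≤ L * y * (c * a) := by gcongr
  have e2 : L * c * 2 ≤ L * c * (y * a) := by gcongr
  have e3 : (L : ℝ) * 4 ≤ L * (c * y * a) := by gcongr
  have e4 : 4 * a ≤ L * (c * y) * a := by gcongr
  have e5 : 1 * 4 ≤ L * (c * y * a) := mul_le_mul hL1 hcya (by norm_num) (by linarith)
  have := Real.log_le_log hn0 hn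
  rw [hlog] at this
  linarith

/-- Up to the factor `2`, the left-hand side is the probability bound for the deviation
`t = Z ^ 2 / √M`, where `Z = L c y (1 + log M)`. -/
theorem pow_mul_exp_le_inv {L M p : ℕ} (hL : 0 < L) (hM : 0 < M) {c y n : ℝ} (hc : 2 ≤ c)
    (hy : 2 ≤ y) (hp : (p : ℝ) ≤ L * y ^ 2) (hn0 : 0 < n)
    (hn : n ≤ 8 * (L * y ^ L * c ^ L) * √(M : ℝ)) :
    n ^ p * Real.exp (-(2 * (L * c * y * (1 + Real.log M)) ^ 4)) ≤ (M : ℝ)⁻¹ := by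
  have hlogn := log_mesh_le hL hM hc hy hn0 hn
  have hL1 : (1 : ℝ) ≤ L := by exact_mod_cast hL
  have hM1 : (1 : ℝ) ≤ M := by exact_mod_cast hM
  have hM0 : (0 : ℝ) < M := by linarith
  have hlM := Real.log_nonneg hM1
  set a := 1 + Real.log M with ha
  have ha1 : 1 ≤ a := by linarith
  have hcy : 4 ≤ c * y := by nlinarith
  have hLcy : 4 ≤ L * (c * y) := hcy.trans (le_mul_of_one_le_left (by linarith) hL1)
  set Z : ℝ := L * c * y * a with hZ
  have haZ : 4 * a ≤ Z := by
    calc 4 * a ≤ L * (c * y) * a := by gcongr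
      _ = Z := by rw [hZ]; ring
  have hZ0 : 0 < Z := by linarith
  have hca : 4 ≤ (c * a) ^ 2 := by
    have : 2 ≤ c * a := hc.trans (le_mul_of_one_le_right (by linarith) ha1)
    nlinarith
  have hpZ : (p : ℝ) * 4 ≤ Z ^ 2 := by
    calc (p : ℝ) * 4 ≤ L * y ^ 2 * (c * a) ^ 2 := by gcongr
      _ ≤ L ^ 2 * y ^ 2 * (c * a) ^ 2 := by
          gcongr; exact le_self_pow₀ hL1 two_ne_zero
      _ = Z ^ 2 := by rw [hZ]; ring
  have hpL : (p : ℝ) * (4 * Z) ≤ Z ^ 4 := by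
    calc (p : ℝ) * (4 * Z) = p * 4 * Z := by ring
      _ ≤ Z ^ 2 * Z := by gcongr
      _ ≤ Z ^ 2 * Z ^ 2 := by gcongr; exact le_self_pow₀ (by linarith) two_ne_zero
      _ = _ := by ring
  have hMZ : Real.log M ≤ Z ^ 4 :=
    (by linarith : Real.log M ≤ Z).trans (le_self_pow₀ (by linarith) (by norm_num))
  have h1 : n ^ p = Real.exp (p * Real.log n) := by
    rw [Real.exp_nat_mul, Real.exp_log hn0]
  rw [h1, ← Real.exp_add, ← Real.exp_log (inv_pos.2 hM0), Real.log_inv]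
  have : p * Real.log n ≤ p * (4 * Z) := by gcongr
  exact Real.exp_le_exp.2 (by linarith)

/-- The choice of the mesh `n` and of the deviation `t = Z ^ 2 / √M`, where
`Z = L c y (1 + log M)`, for which the generalization error is at most the last summand of the bound. -/
theorem exists_mesh_and_deviation {L M p : ℕ} (hL : 0 < L) (hM : 0 < M) {c y : ℝ} (hc : 2 ≤ c)
    (hy : 2 ≤ y) (hp : (p : ℝ) ≤ L * y ^ 2) :
    ∃ n : ℕ, 0 < n ∧ ∃ t : ℝ, 0 ≤ t ∧
      √(2 * (t + 4 * (L * y ^ L * c ^ (L - 1) * (c / n)))) +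
        n ^ p * (2 * Real.exp (-(2 * M * t ^ 2))) ≤
      4 * c * L * y * Real.log (Real.exp 1 * M) / (M : ℝ) ^ (1 / 4 : ℝ) := by
  have hL1 : (1 : ℝ) ≤ L := by exact_mod_cast hL
  have hM1 : (1 : ℝ) ≤ M := by exact_mod_cast hM
  have hM0 : (0 : ℝ) < M := by linarith
  have hlogM : Real.log (Real.exp 1 * M) = 1 + Real.log M := by
    rw [Real.log_mul (Real.exp_pos 1).ne' hM0.ne', Real.log_exp]
  have hlM := Real.log_nonneg hM1
  have hsM1 : 1 ≤ √(M : ℝ) := Real.one_le_sqrt.2 hM1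
  have hLam : (L : ℝ) * y ^ L * c ^ (L - 1) * c = L * y ^ L * c ^ L := by
    rw [mul_assoc, ← pow_succ, Nat.sub_add_cancel hL]
  have hB1 : 1 ≤ L * y ^ L * c ^ L :=
    one_le_mul_of_one_le_of_one_le (one_le_mul_of_one_le_of_one_le hL1
      (one_le_pow₀ (by linarith))) (one_le_pow₀ (by linarith))
  have hBM := one_le_mul_of_one_le_of_one_le hB1 hsM1
  have hn : 0 < ⌈4 * (L * y ^ L * c ^ L * √(M : ℝ))⌉₊ := Nat.ceil_pos.2 (by linarith)
  have hn_ge := Nat.le_ceil (4 * (L * y ^ L * c ^ L * √(M : ℝ)))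
  have hn_lt := Nat.ceil_lt_add_one (show 0 ≤ 4 * (L * y ^ L * c ^ L * √(M : ℝ)) by linarith)
  refine ⟨⌈4 * (L * y ^ L * c ^ L * √(M : ℝ))⌉₊, hn,
    (L * c * y * (1 + Real.log M)) ^ 2 / √(M : ℝ), by positivity, ?_⟩
  generalize ⌈4 * (L * y ^ L * c ^ L * √(M : ℝ))⌉₊ = n at *
  have hn0 : (0 : ℝ) < n := by exact_mod_cast hn
  have hprob := pow_mul_exp_le_inv hL hM hc hy hp hn0 (by linarith)
  have hmesh : 4 * (L * y ^ L * c ^ (L - 1) * (c / n)) ≤ 1 / √(M : ℝ) := by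
    rw [← mul_div_assoc, hLam, ← mul_div_assoc, div_le_div_iff₀ hn0 (by linarith)]
    linarith
  have hcy : 4 ≤ c * y := by nlinarith
  have hZ1 : 1 ≤ L * c * y * (1 + Real.log M) := by
    rw [mul_assoc (L : ℝ)]
    exact one_le_mul_of_one_le_of_one_le
      (one_le_mul_of_one_le_of_one_le hL1 (by linarith)) (by linarith)
  have hgoal : 4 * c * L * y * Real.log (Real.exp 1 * M) =
      4 * (L * c * y * (1 + Real.log M)) := by rw [hlogM]; ring
  rw [hgoal]
  generalize L * c * y * (1 + Real.log M) = Z at *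
  generalize 4 * (L * y ^ L * c ^ (L - 1) * (c / n)) = r at *
  have hM2 : 2 * M * (Z ^ 2 / √(M : ℝ)) ^ 2 = 2 * Z ^ 4 := by
    rw [div_pow, Real.sq_sqrt hM0.le]; field_simp
  rw [hM2]
  have hqM : √(M : ℝ) = ((M : ℝ) ^ (1 / 4 : ℝ)) ^ 2 := by
    rw [← Real.rpow_natCast, ← Real.rpow_mul hM0.le, Real.sqrt_eq_rpow]; norm_num
  have hMq : (M : ℝ) = ((M : ℝ) ^ (1 / 4 : ℝ)) ^ 4 := by
    rw [← Real.rpow_natCast, ← Real.rpow_mul hM0.le]; norm_num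
  have hq1 : 1 ≤ (M : ℝ) ^ (1 / 4 : ℝ) := Real.one_le_rpow hM1 (by norm_num)
  have hMinv : (M : ℝ)⁻¹ ≤ ((M : ℝ) ^ (1 / 4 : ℝ))⁻¹ :=
    inv_anti₀ (by linarith) ((le_self_pow₀ hq1 (by norm_num)).trans_eq hMq.symm)
  rw [hqM] at hmesh ⊢
  set q := (M : ℝ) ^ (1 / 4 : ℝ)
  have hsqrt : √(2 * (Z ^ 2 / q ^ 2 + r)) ≤ 2 * Z / q := by
    refine Real.sqrt_le_iff.2 ⟨by positivity, ?_⟩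
    calc 2 * (Z ^ 2 / q ^ 2 + r) ≤ 2 * (Z ^ 2 / q ^ 2 + 1 / q ^ 2) := by gcongr
      _ = (2 * (Z ^ 2 + 1)) / q ^ 2 := by ring
      _ ≤ (2 * Z) ^ 2 / q ^ 2 := by gcongr; nlinarith
      _ = _ := by rw [div_pow]
  calc _ ≤ 2 * Z / q + 2 * Z / q := by
        refine add_le_add hsqrt ?_
        calc (n : ℝ) ^ p * (2 * Real.exp (-(2 * Z ^ 4)))
            = 2 * ((n : ℝ) ^ p * Real.exp (-(2 * Z ^ 4))) := by ring
          _ ≤ 2 * q⁻¹ := by gcongr; exact hprob.trans hMinv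
          _ ≤ 2 * (Z * q⁻¹) := by gcongr; exact le_mul_of_one_le_left (by positivity) hZ1
          _ = _ := by ring
    _ = _ := by ring

/-- Since `p ≤ L y ^ 2` and `2 c ≤ c ^ 2`, the optimization error `Λ · 2 c K ^ (-1/p)` is at most the
second summand of the bound. -/
theorem two_mul_div_rpow_le {L K p : ℕ} (hL : 0 < L) (hK : 0 < K) (hp0 : 0 < p) {c y : ℝ}
    (hc : 2 ≤ c) (hy : 0 < y) (hp : (p : ℝ) ≤ L * y ^ 2) :
    L * y ^ L * c ^ (L - 1) * (2 * c / (K : ℝ) ^ (1 / (p : ℝ))) ≤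
      L * y ^ L * c ^ (L + 1) / (K : ℝ) ^ ((2 * (L : ℝ))⁻¹ * (y ^ 2)⁻¹) := by
  have hK1 : (1 : ℝ) ≤ K := by exact_mod_cast hK
  have hL1 : (1 : ℝ) ≤ L := by exact_mod_cast hL
  have hp1 : (0 : ℝ) < p := by exact_mod_cast hp0
  have hexp : (K : ℝ) ^ ((2 * (L : ℝ))⁻¹ * (y ^ 2)⁻¹) ≤ (K : ℝ) ^ (1 / (p : ℝ)) := by
    refine Real.rpow_le_rpow_of_exponent_le hK1 ?_
    rw [← mul_inv, one_div]
    refine inv_anti₀ hp1 (hp.trans ?_)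
    have : 0 ≤ (L : ℝ) * y ^ 2 := by positivity
    linarith
  rw [← mul_div_assoc]
  have hc0 : 0 < c := by linarith
  have hpow : c ^ (L + 1) = c ^ (L - 1) * (c * c) := by
    rw [← pow_two, ← pow_add]; congr 1; omega
  refine div_le_div₀ (by positivity) ?_ (Real.rpow_pos_of_pos (by linarith) _) hexp
  rw [hpow, ← mul_assoc (L * y ^ L : ℝ)]
  have : 0 ≤ L * y ^ L * c ^ (L - 1) := by positivity
  exact mul_le_mul_of_nonneg_left (by nlinarith) this

end ClippedDNN

theorem theorem1p1
    (d D L M K N : ℕ) (hM : 0 < M) (hK : 0 < K) (hN : 0 < N) (hLpos : 0 < L)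
    (c : ℝ) (hc : 2 ≤ c) (γ : ℝ)
    (l : ℕ → ℕ) (hl : ∀ i ≤ L, 0 < l i) (h0 : l 0 = d) (hL : l L = 1)
    (hD : numParams l L ≤ D)
    {Ω : Type*} [MeasurableSpace Ω] (P : Measure Ω) [IsProbabilityMeasure P]
    (X : Fin M → Ω → Cube d)
    (hXmeas : ∀ j, Measurable (X j))
    (hXindep : iIndepFun X P)
    (hXident : ∀ j, IdentDistrib (X j) (X ⟨0, hM⟩) P P)
    (E : Cube d → unitInterval)
    (hE : ∀ x y : Cube d,
      |(E x : ℝ) - (E y : ℝ)| ≤ c * ∑ i : Fin d, |(x : Fin d → ℝ) i - (y : Fin d → ℝ) i|)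
    (Θ : ℕ → ℕ → Ω → Fin D → ℝ)
    (hΘmeas : ∀ k n, Measurable (Θ k n))
    (hΘindep : iIndepFun (fun k : Set.Icc 1 K => Θ (k : ℕ) 0) P)
    (hΘident : ∀ k ∈ Set.Icc 1 K, IdentDistrib (Θ k 0) (Θ 1 0) P P)
    (hΘunif : pdf.IsUniform (Θ 1 0) (Set.Icc (fun _ => -c) (fun _ => c)) P volume)
    (R : (Fin D → ℝ) → Ω → ℝ)
    (hR : ∀ θ ω, R θ ω = empiricalRisk h0 hL E (fun j => X j ω) θ)
    (G : (Fin D → ℝ) → Ω → Fin D → ℝ)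
    (hG : ∀ ω θ, DifferentiableAt ℝ (fun ϑ => R ϑ ω) θ → G θ ω = grad (fun ϑ => R ϑ ω) θ)
    (hGD : ∀ k n, 1 ≤ k → 1 ≤ n → ∀ ω,
      Θ k n ω = Θ k (n - 1) ω - γ • G (Θ k (n - 1) ω) ω)
    (κ : Ω → ℕ × ℕ) (hκmeas : Measurable κ)
    (hκ : ∀ ω, κ ω ∈ argMin (admissible K N c (fun k n => Θ k n ω))
      (fun p => R (Θ p.1 p.2 ω) ω)) :
    (∀ ω, Integrable
      (fun x : Cube d => |realization h0 hL (Θ (κ ω).1 (κ ω).2 ω) x - (E x : ℝ)|)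
      (P.map (X ⟨0, hM⟩))) ∧
    Integrable
      (fun ω => ∫ x : Cube d, |realization h0 hL (Θ (κ ω).1 (κ ω).2 ω) x - (E x : ℝ)|
        ∂(P.map (X ⟨0, hM⟩))) P ∧
    ∫ ω, (∫ x : Cube d, |realization h0 hL (Θ (κ ω).1 (κ ω).2 ω) x - (E x : ℝ)|
        ∂(P.map (X ⟨0, hM⟩))) ∂P
      ≤ 6 * (d : ℝ) * c / (minWidth l L : ℝ) ^ (1 / (d : ℝ))
        + (L : ℝ) * ((maxWidth l L : ℝ) + 1) ^ L * c ^ (L + 1)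
            / (K : ℝ) ^ ((2 * (L : ℝ))⁻¹ * (((maxWidth l L : ℝ) + 1) ^ 2)⁻¹)
        + 4 * c * (L : ℝ) * ((maxWidth l L : ℝ) + 1) * Real.log (Real.exp 1 * (M : ℝ))
            / (M : ℝ) ^ (1 / 4 : ℝ) := by
  classical
  have hc0 : 0 < c := by linarith
  have hEm := measurable_of_lipschitz_sum hc0.le hE
  have hκ₂ : Measurable fun ω => Θ (κ ω).1 (κ ω).2 ω :=
    (measurable_from_prod_countable_right (f := fun q : (ℕ × ℕ) × Ω => Θ q.1.1 q.1.2 q.2)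
      fun q => hΘmeas q.1 q.2).comp (hκmeas.prodMk measurable_id)
  set ν := P.map (X ⟨0, hM⟩) with hν
  have : IsProbabilityMeasure ν := Measure.isProbabilityMeasure_map (hXmeas _).aemeasurable
  have hm1 : 1 ≤ maxWidth l L := (hl 0 (Nat.zero_le _)).trans_le (le_maxWidth l L 0 (Nat.zero_le _))
  have hy : (2 : ℝ) ≤ (maxWidth l L : ℝ) + 1 := by
    have : (1 : ℝ) ≤ maxWidth l L := by exact_mod_cast hm1
    linarith
  have hp : (numParams l L : ℝ) ≤ L * ((maxWidth l L : ℝ) + 1) ^ 2 := by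
    have h1 : (numParams l L : ℝ) ≤ L * (maxWidth l L * (maxWidth l L + 1)) := by
      exact_mod_cast numParams_le (le_maxWidth l L)
    refine h1.trans ?_
    gcongr
    nlinarith
  have hp0 : 0 < numParams l L := by
    refine lt_of_lt_of_le ?_ (numParams_mono l (show 1 ≤ L from hLpos))
    rw [numParams_succ]
    have := hl 1 hLpos
    positivity
  set J : Ω → ℝ := fun ω => ∫ x : Cube d, |realization h0 hL (Θ (κ ω).1 (κ ω).2 ω) x - (E x : ℝ)| ∂ν
    with hJ
  have hfm : ∀ θ : Fin D → ℝ, Measurable fun x : Cube d => |realization h0 hL θ x - (E x : ℝ)| :=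
    fun θ => ((measurable_realization h0 hL measurable_const measurable_subtype_coe).sub hEm).norm
  have hf01 : ∀ (θ : Fin D → ℝ) (x : Cube d),
      |realization h0 hL θ x - (E x : ℝ)| ∈ Set.Icc (0 : ℝ) 1 := fun θ x =>
    ⟨abs_nonneg _, abs_sub_le_one (realization_mem_Icc h0 hL hLpos _ _) (E x).2⟩
  have hfint : ∀ θ : Fin D → ℝ,
      Integrable (fun x : Cube d => |realization h0 hL θ x - (E x : ℝ)|) ν := fun θ =>
    Integrable.of_mem_Icc 0 1 (hfm θ).aemeasurable (ae_of_all _ (hf01 θ))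
  have hJm : StronglyMeasurable J := by
    have : Measurable fun q : Ω × Cube d =>
        |realization h0 hL (Θ (κ q.1).1 (κ q.1).2 q.1) q.2 - (E q.2 : ℝ)| :=
      ((measurable_realization h0 hL (hκ₂.comp measurable_fst)
        (measurable_subtype_coe.comp measurable_snd)).sub (hEm.comp measurable_snd)).norm
    exact this.stronglyMeasurable.integral_prod_right'
  have hJ01 : ∀ ω, J ω ∈ Set.Icc (0 : ℝ) 1 := fun ω =>
    ⟨integral_nonneg fun x => abs_nonneg _, by
      simpa using integral_mono (hfint (Θ (κ ω).1 (κ ω).2 ω)) (integrable_const 1)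
        fun x => (hf01 _ x).2⟩
  have hJint : Integrable J P :=
    Integrable.of_mem_Icc 0 1 hJm.measurable.aemeasurable (ae_of_all _ hJ01)
  refine ⟨fun ω => hfint _, hJint, ?_⟩
  -- the three sources of error
  obtain ⟨ϑ, hϑ, happrox⟩ := exists_abs_realization_sub_le h0 hL hLpos hl hD hc E hE
  obtain ⟨n, hn, t, ht, hgen⟩ := exists_mesh_and_deviation hLpos hM hc hy hp
  obtain ⟨A, hAm, hPA, hA⟩ := exists_measurableSet_abs_risk_sub_le h0 hL E hM hXmeas hXindep
    hXident hLpos hEm hD (by linarith : 1 ≤ c) hn ht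
  have : Nonempty (Set.Icc 1 K) := ⟨⟨1, le_rfl, hK⟩⟩
  have hunif : ∀ k : Set.Icc 1 K,
      pdf.IsUniform (Θ (k : ℕ) 0) (Set.Icc (fun _ => -c) (fun _ => c)) P volume := fun k => by
    rw [pdf.IsUniform, (hΘident k k.2).map_eq]; exact hΘunif
  obtain ⟨hIint, hIle⟩ := integral_inf_headDist_le hc0 (fun k : Set.Icc 1 K => hΘmeas k 0)
    hΘindep hunif hp0 hD hϑ
  set I : Ω → ℝ := fun ω => Finset.univ.inf' Finset.univ_nonempty
    fun k : Set.Icc 1 K => headDist (numParams l L) (Θ k 0 ω) ϑ with hI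
  set ε := 6 * (d : ℝ) * c / (minWidth l L : ℝ) ^ (1 / (d : ℝ)) with hε
  set Λ : ℝ := L * ((maxWidth l L : ℝ) + 1) ^ L * c ^ (L - 1) with hΛ
  set η : ℝ := t + 4 * (Λ * (c / n)) with hη
  have hε0 : 0 ≤ ε := by positivity
  have hΛ0 : 0 ≤ Λ := by positivity
  have hη0 : 0 ≤ η := by positivity
  have hI0 : ∀ ω, 0 ≤ I ω := fun ω => Finset.le_inf' _ _ fun k _ => norm_nonneg _
  have hpoint : ∀ᵐ ω ∂P, J ω ≤ ε + Λ * I ω + √(2 * η) + A.indicator 1 ω := by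
    filter_upwards [ae_all_iff.2 fun k : Set.Icc 1 K =>
      ae_norm_le_of_isUniform hc0 (hΘmeas k 0) (hunif k)] with ω hω
    by_cases hωA : ω ∈ A
    · have h1 := (hJ01 ω).2
      have h2 := mul_nonneg hΛ0 (hI0 ω)
      have h3 := Real.sqrt_nonneg (2 * η)
      rw [Set.indicator_of_mem hωA, Pi.one_apply]
      linarith
    · rw [Set.indicator_of_notMem hωA, add_zero]
      obtain ⟨k, -, hk⟩ := Finset.exists_mem_eq_inf' Finset.univ_nonempty
        fun k : Set.Icc 1 K => headDist (numParams l L) (Θ k 0 ω) ϑ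
      have hkI : I ω = headDist (numParams l L) (Θ k 0 ω) ϑ := hk
      obtain ⟨⟨-, -, hκnorm⟩, hκmin⟩ := hκ ω
      have hmin := hκmin ((k : ℕ), 0) ⟨k.2, ⟨le_rfl, Nat.zero_le _⟩, hω k⟩
      dsimp only at hmin
      rw [hR, hR] at hmin
      have h1 := (abs_le.1 (hA ω hωA _ hκnorm)).1
      have h2 := (abs_le.1 (hA ω hωA _ (hω k))).2
      have hsup : ∀ x : Cube d, |realization h0 hL (Θ k 0 ω) x - (E x : ℝ)| ≤ ε + Λ * I ω := by
        intro x
        have hLip := abs_realization_sub_le h0 hL hLpos (by linarith : 1 ≤ c) (hω k) hϑ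
          (le_maxWidth l L) (norm_nonneg _) (fun i hi => abs_param_sub_le_headDist hi _ ϑ) x
        rw [hkI, add_comm]
        exact (abs_sub_le _ _ _).trans (add_le_add hLip (happrox x))
      have h3 := trueRisk_le_sq (ν := ν) h0 hL E hLpos hEm hsup
      have h4 := integral_abs_sub_sq_le_trueRisk (ν := ν) h0 hL E hLpos hEm (Θ (κ ω).1 (κ ω).2 ω)
      exact le_add_sqrt_of_sq_le (add_nonneg hε0 (mul_nonneg hΛ0 (hI0 ω))) (by linarith)
        (by change J ω ^ 2 ≤ _ at h4; linarith)
  have hAint : Integrable (A.indicator (1 : Ω → ℝ)) P := (integrable_const 1).indicator hAm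
  have hεI : Integrable (fun ω => ε + Λ * I ω) P := (integrable_const _).add (hIint.const_mul Λ)
  have hbint : Integrable (fun ω => ε + Λ * I ω + √(2 * η)) P := hεI.add (integrable_const _)
  calc ∫ ω, J ω ∂P ≤ ∫ ω, (ε + Λ * I ω + √(2 * η) + A.indicator 1 ω) ∂P :=
        integral_mono_ae hJint (hbint.add hAint) hpoint
    _ = ε + Λ * ∫ ω, I ω ∂P + √(2 * η) + P.real A := by
        rw [integral_add hbint hAint, integral_add hεI (integrable_const _), integral_add (integrable_const _) (hIint.const_mul Λ),
          integral_const_mul, integral_indicator_one hAm]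
        simp
    _ ≤ ε + Λ * (2 * c / (K : ℝ) ^ (1 / (numParams l L : ℝ))) + (√(2 * η) + P.real A) := by
        rw [add_assoc (_ + _)]
        gcongr
        simpa using hIle
    _ ≤ _ := by
        refine add_le_add (add_le_add le_rfl ?_) ((add_le_add le_rfl hPA).trans hgen)
        exact two_mul_div_rpow_le hLpos hK hp0 hc (by linarith) hp
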